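/- Let $m\ge n\ge 1$ be integers. For polynomials $p(x)=\sum_{i=0}^n(-1)^i a_i x^{n-i}$ and $q(x)=\sum_{i=0}^n(-1)^i b_i x^{n-i}$ of degree $n$, define the rectangular additive convolution $$(p\boxplus_{m,n}q)(x)=\sum_{\ell=0}^n x^{n-\ell}(-1)^\ell\sum_{i+j=\ell}\frac{(n-i)!\,(n-j)!}{n!\,(n-\ell)!}\,\frac{(m-i)!\,(m-j)!}{m!\,(m-\ell)!}\,a_i b_j .$$ For a real number $\theta$ and an integer $d\ge 1$, let $f_d=(x-\theta)^n\boxplus_{m,n}\cdots\boxplus_{m,n}(x-\theta)^n$ ($d$ copies of $(x-\theta)^n$, convolved from left to right), and let $q_d^{[\theta,m,n]}(x)=f_d(x^2)$. Then for every real $\theta\ge 2$ and all integers $n\ge1$, $m\ge n$ and $d\ge 2$, the polynomial $q_d^{[\theta,m,n]}$ is real-rooted, and its largest root $\lambda_1\bigl(q_d^{[\theta,m,n]}\bigr)$ satisfies $$\lambda_1\bigl(q_d^{[\theta,m,n]}\bigr)\le\sqrt{\frac{\theta n}{m}}\left(\sqrt{d-1}+\sqrt{\frac{dm}{n}-1}\right).$$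 -/

import Mathlib

open Polynomial
open scoped Nat

noncomputable section

/-- The coefficient `a_i` of a polynomial written as
`p(x) = ∑_{i=0}^n x^(n-i) (-1)^i a_i` (for `i ≤ n`). -/
def signedCoeff (n : ℕ) (p : ℝ[X]) (i : ℕ) : ℝ :=
  (-1) ^ i * p.coeff (n - i)

/-- The rectangular additive convolution `p ⊞_{m,n} q` of two polynomials of degree `n`,
for `m ≥ n`. All indices below satisfy `i, j ≤ ℓ ≤ n ≤ m`, so no subtraction truncates. -/
def rectConv (m n : ℕ) (p q : ℝ[X]) : ℝ[X] :=
  ∑ l ∈ Finset.range (n + 1),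
    C ((-1) ^ l * ∑ ij ∈ Finset.HasAntidiagonal.antidiagonal l,
      (((n - ij.1)! : ℝ) * ((n - ij.2)! : ℝ)) / ((n ! : ℝ) * ((n - l)! : ℝ)) *
      ((((m - ij.1)! : ℝ) * ((m - ij.2)! : ℝ)) / ((m ! : ℝ) * ((m - l)! : ℝ))) *
      signedCoeff n p ij.1 * signedCoeff n q ij.2) * X ^ (n - l)

/-- The `d`-fold convolution `p ⊞_{m,n} p ⊞_{m,n} ⋯ ⊞_{m,n} p` (`d` copies of `p`).
The empty convolution is the neutral element `x^n`. -/
def rectConvPow (m n : ℕ) (p : ℝ[X]) : ℕ → ℝ[X]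
  | 0 => X ^ n
  | 1 => p
  | d + 2 => rectConv m n (rectConvPow m n p (d + 1)) p

/-- The operator `p(x) ↦ p(x^2)` on polynomials. -/
def substSq (p : ℝ[X]) : ℝ[X] := p.comp (X ^ 2)

/-- The polynomial `q_d^{[θ,m,n]}(x)`: the `d`-fold rectangular additive convolution of
`(x - θ)^n`, evaluated at `x^2`. -/
def qPoly (θ : ℝ) (m n d : ℕ) : ℝ[X] :=
  substSq (rectConvPow m n ((X - C θ) ^ n) d)

end

/-! Dividing the signed coefficients by suitable factorials turns `rectConv` into multiplication of
power series, so f_d is `powPoly`, built from `genSeries m ^ d`. Hence θ only dilates the roots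
(`powPoly_eval_mul`), and lowering n at fixed m is differentiation up to a constant
(`powPoly_derivative`). Everything reduces to θ = 1, n = m, followed by m - n derivatives.

For n = m, f_d(x²) is the average, over d-tuples of permutations of m points, of the matching
polynomial of the d-regular bipartite multigraph they form (`powPoly_eval_sq`). The Heilmann–Lieb
induction (`matchingPoly_estimates`) gives, for 0 < t < 1 and x ≥ (d-1)t + 1/t, both f_d(x²) > 0 and
f_d'/f_d ≤ m/((x-dt)x) at x². An average of real-rooted polynomials need not be real-rooted, so that
property is proved separately, by a Grace-type theorem (`diagonal_contraction_ne_zero`) used by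
induction on d in `powPoly_self_complex_roots`.

With δ = (x-dt)x/m, each derivative moves the upper barrier x² to the left by δ
(`barrier_derivative`). After m - n derivatives, optimising over t bounds the roots by (√(ρ(d-1)) +
√(d-ρ))² with ρ = n/m; multiplying by θ and taking square roots gives the claim. -/

noncomputable section

/-! ### Closed form of the convolution powers -/

/-- The normalised generating series of `(x - 1) ^ n` for the rectangular convolution. -/
def genSeries (m : ℕ) : PowerSeries ℝ :=
  PowerSeries.mk fun i => ((m - i)! : ℝ) / ((m ! : ℝ) * (i ! : ℝ))

/-- The polynomial whose `i`-th signed coefficient is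
`n! m! / ((n - i)! (m - i)!) * θ ^ i` times the `i`-th coefficient of `genSeries m ^ d`. -/
def powPoly (m n d : ℕ) (θ : ℝ) : ℝ[X] :=
  ∑ l ∈ Finset.range (n + 1),
    C ((-1) ^ l * ((n ! : ℝ) * (m ! : ℝ) / (((n - l)! : ℝ) * ((m - l)! : ℝ)) * θ ^ l *
      PowerSeries.coeff l (genSeries m ^ d))) * X ^ (n - l)

lemma coeff_sum_C_mul_X_pow_sub (n l : ℕ) (hl : l ≤ n) (c : ℕ → ℝ) :
    (∑ k ∈ Finset.range (n + 1), C (c k) * X ^ (n - k)).coeff (n - l) = c l := by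
  rw [finsetSum_coeff, Finset.sum_eq_single l]
  · simp
  · intro k hk hkl
    have : n - l ≠ n - k := by
      have := Finset.mem_range.1 hk
      omega
    rw [coeff_C_mul_X_pow, if_neg this]
  · intro h
    exact absurd (Finset.mem_range.2 (by omega)) h

lemma signedCoeff_sum (n l : ℕ) (hl : l ≤ n) (c : ℕ → ℝ) :
    signedCoeff n (∑ k ∈ Finset.range (n + 1), C ((-1) ^ k * c k) * X ^ (n - k)) l = c l := by
  rw [signedCoeff, coeff_sum_C_mul_X_pow_sub n l hl (fun k => (-1) ^ k * c k), ← mul_assoc,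
    ← mul_pow]
  simp

lemma signedCoeff_X_sub_C_pow (n l : ℕ) (hl : l ≤ n) (θ : ℝ) :
    signedCoeff n ((X - C θ) ^ n) l = (n.choose l : ℝ) * θ ^ l := by
  rw [signedCoeff, sub_eq_add_neg, ← C_neg, coeff_X_add_C_pow, Nat.sub_sub_self hl,
    Nat.choose_symm hl, neg_pow]
  have : ((-1 : ℝ) ^ l) * (-1) ^ l = 1 := by rw [← mul_pow]; simp
  linear_combination (n.choose l : ℝ) * θ ^ l * this

lemma eq_sum_signedCoeff (n : ℕ) (p : ℝ[X]) (hp : p.natDegree ≤ n) :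
    p = ∑ k ∈ Finset.range (n + 1), C ((-1) ^ k * signedCoeff n p k) * X ^ (n - k) := by
  ext k
  by_cases hk : k ≤ n
  · obtain ⟨l, hl, rfl⟩ : ∃ l, l ≤ n ∧ k = n - l := ⟨n - k, by omega, by omega⟩
    rw [coeff_sum_C_mul_X_pow_sub n l hl (fun k => (-1) ^ k * signedCoeff n p k), signedCoeff,
      ← mul_assoc, ← mul_pow]
    simp
  · rw [coeff_eq_zero_of_natDegree_lt (by omega), finsetSum_coeff]
    refine (Finset.sum_eq_zero fun i _ => ?_).symm
    rw [coeff_C_mul_X_pow, if_neg (by omega)]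

lemma powPoly_one (m n : ℕ) (θ : ℝ) : powPoly m n 1 θ = (X - C θ) ^ n := by
  rw [eq_sum_signedCoeff n ((X - C θ) ^ n) (by simp), powPoly]
  refine Finset.sum_congr rfl fun l hl => ?_
  have hl : l ≤ n := by have := Finset.mem_range.1 hl; omega
  rw [signedCoeff_X_sub_C_pow n l hl, Nat.cast_choose ℝ hl, pow_one, genSeries,
    PowerSeries.coeff_mk]
  congr 3
  have := Nat.factorial_ne_zero
  field_simp

/-- Once a_i is written as n! m! / ((n-i)! (m-i)!) · α_i, the weights of the convolution cancel and
α is convolved by the Cauchy product. -/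
lemma rectConv_powPoly (m n d : ℕ) (θ : ℝ) :
    rectConv m n (powPoly m n d θ) (powPoly m n 1 θ) = powPoly m n (d + 1) θ := by
  rw [rectConv]
  conv_rhs => rw [powPoly]
  refine Finset.sum_congr rfl fun l hl => ?_
  have hl : l ≤ n := by have := Finset.mem_range.1 hl; omega
  refine congrArg (fun c => C ((-1) ^ l * c) * X ^ (n - l)) ?_
  rw [pow_succ, PowerSeries.coeff_mul, Finset.mul_sum]
  refine Finset.sum_congr rfl fun ij hij => ?_
  have hij := Finset.HasAntidiagonal.mem_antidiagonal.1 hij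
  rw [powPoly, signedCoeff_sum n _ (by omega), powPoly, signedCoeff_sum n _ (by omega), ← hij,
    pow_add, pow_one]
  have := Nat.factorial_ne_zero
  field_simp

lemma rectConvPow_eq_powPoly (m n d : ℕ) (θ : ℝ) :
    rectConvPow m n ((X - C θ) ^ n) (d + 1) = powPoly m n (d + 1) θ := by
  induction d with
  | zero => rw [powPoly_one m n, rectConvPow]
  | succ d ih => rw [rectConvPow, ih, ← rectConv_powPoly m n (d + 1), powPoly_one m n]

lemma genSeries_coeff_nonneg (m d l : ℕ) : 0 ≤ PowerSeries.coeff l (genSeries m ^ d) := by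
  induction d generalizing l with
  | zero => rw [pow_zero, PowerSeries.coeff_one]; split_ifs <;> norm_num
  | succ d ih =>
    rw [pow_succ, PowerSeries.coeff_mul]
    refine Finset.sum_nonneg fun ij _ => mul_nonneg (ih _) ?_
    rw [genSeries, PowerSeries.coeff_mk]
    positivity

lemma genSeries_coeff_zero (m d : ℕ) : PowerSeries.coeff 0 (genSeries m ^ d) = 1 := by
  have : PowerSeries.constantCoeff (genSeries m) = 1 := by
    rw [← PowerSeries.coeff_zero_eq_constantCoeff_apply, genSeries, PowerSeries.coeff_mk]
    have := Nat.factorial_ne_zero m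
    simp [this]
  simp [this]

lemma powPoly_natDegree_le (m n d : ℕ) (θ : ℝ) : (powPoly m n d θ).natDegree ≤ n :=
  natDegree_sum_le_of_forall_le _ _ fun l _ =>
    (natDegree_C_mul_X_pow_le _ _).trans (Nat.sub_le n l)

lemma powPoly_monic (m n d : ℕ) (θ : ℝ) : (powPoly m n d θ).Monic := by
  refine monic_of_natDegree_le_of_coeff_eq_one n (powPoly_natDegree_le m n d θ) ?_
  have := coeff_sum_C_mul_X_pow_sub n 0 (Nat.zero_le n) (fun l => (-1) ^ l *
    ((n ! : ℝ) * (m ! : ℝ) / (((n - l)! : ℝ) * ((m - l)! : ℝ)) * θ ^ l *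
      PowerSeries.coeff l (genSeries m ^ d)))
  rw [Nat.sub_zero] at this
  rw [powPoly, this, genSeries_coeff_zero]
  have := Nat.factorial_ne_zero
  simp [this]

lemma powPoly_natDegree (m n d : ℕ) (θ : ℝ) : (powPoly m n d θ).natDegree = n := by
  refine le_antisymm (powPoly_natDegree_le m n d θ) ?_
  refine le_natDegree_of_ne_zero ?_
  have := coeff_sum_C_mul_X_pow_sub n 0 (Nat.zero_le n) (fun l => (-1) ^ l *
    ((n ! : ℝ) * (m ! : ℝ) / (((n - l)! : ℝ) * ((m - l)! : ℝ)) * θ ^ l *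
      PowerSeries.coeff l (genSeries m ^ d)))
  rw [Nat.sub_zero] at this
  rw [powPoly, this, genSeries_coeff_zero]
  have := Nat.factorial_ne_zero
  simp [this]

lemma powPoly_eval (m n d : ℕ) (θ x : ℝ) : (powPoly m n d θ).eval x =
    ∑ l ∈ Finset.range (n + 1), (-1) ^ l *
      ((n ! : ℝ) * (m ! : ℝ) / (((n - l)! : ℝ) * ((m - l)! : ℝ)) * θ ^ l *
      PowerSeries.coeff l (genSeries m ^ d)) * x ^ (n - l) := by
  rw [powPoly, eval_finsetSum]
  simp only [eval_mul, eval_C, eval_pow, eval_X]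

lemma powPoly_eval_mul (m n d : ℕ) (θ x : ℝ) :
    (powPoly m n d θ).eval (θ * x) = θ ^ n * (powPoly m n d 1).eval x := by
  rw [powPoly_eval, powPoly_eval, Finset.mul_sum]
  refine Finset.sum_congr rfl fun l hl => ?_
  have hl : n = l + (n - l) := by have := Finset.mem_range.1 hl; omega
  have : θ ^ n = θ ^ l * θ ^ (n - l) := by rw [← pow_add, ← hl]
  rw [this, mul_pow, one_pow]
  ring

/-- A polynomial with alternating coefficients has no negative root. -/
lemma powPoly_root_nonneg (m n d : ℕ) (θ x : ℝ) (hθ : 0 ≤ θ)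
    (hx : (powPoly m n d θ).eval x = 0) : 0 ≤ x := by
  by_contra! h
  have key : (powPoly m n d θ).eval x = (-1) ^ n * ∑ l ∈ Finset.range (n + 1),
      ((n ! : ℝ) * (m ! : ℝ) / (((n - l)! : ℝ) * ((m - l)! : ℝ)) * θ ^ l *
      PowerSeries.coeff l (genSeries m ^ d)) * (-x) ^ (n - l) := by
    rw [powPoly_eval, Finset.mul_sum]
    refine Finset.sum_congr rfl fun l hl => ?_
    have hl : n = l + (n - l) := by have := Finset.mem_range.1 hl; omega
    have h1 : (-1 : ℝ) ^ n = (-1) ^ l * (-1) ^ (n - l) := by rw [← pow_add, ← hl]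
    have h2 : (-1 : ℝ) ^ (n - l) * (-1) ^ (n - l) = 1 := by rw [← mul_pow]; simp
    rw [h1, neg_pow x]
    linear_combination (-(-1) ^ l * ((n ! : ℝ) * (m ! : ℝ) / (((n - l)! : ℝ) * ((m - l)! : ℝ)) *
      θ ^ l * PowerSeries.coeff l (genSeries m ^ d)) * x ^ (n - l)) * h2
  rw [key] at hx
  have hpos : 0 < ∑ l ∈ Finset.range (n + 1),
      ((n ! : ℝ) * (m ! : ℝ) / (((n - l)! : ℝ) * ((m - l)! : ℝ)) * θ ^ l *
      PowerSeries.coeff l (genSeries m ^ d)) * (-x) ^ (n - l) := by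
    have hx' : 0 < -x := by linarith
    refine Finset.sum_pos' (fun l _ => ?_) ⟨0, by simp, ?_⟩
    · have := genSeries_coeff_nonneg m d l
      positivity
    · rw [genSeries_coeff_zero]
      positivity
  rcases mul_eq_zero.1 hx with h1 | h1
  · exact absurd h1 (by simp)
  · linarith

/-- `genSeries m` does not involve n; n enters the coefficients only through n!/(n-l)!, and this is
the factor that differentiation adjusts. -/
lemma powPoly_derivative (m n d : ℕ) :
    derivative (powPoly m (n + 1) d 1) = C ((n + 1 : ℕ) : ℝ) * powPoly m n d 1 := by
  rw [powPoly, powPoly, Finset.sum_range_succ, derivative_add, Finset.mul_sum, derivative_sum]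
  have : derivative (C ((-1) ^ (n + 1) * (((n + 1)! : ℝ) * (m ! : ℝ) /
      (((n + 1 - (n + 1))! : ℝ) * ((m - (n + 1))! : ℝ)) * 1 ^ (n + 1) *
      PowerSeries.coeff (n + 1) (genSeries m ^ d))) * X ^ (n + 1 - (n + 1))) = 0 := by
    rw [Nat.sub_self, pow_zero, mul_one, derivative_C]
  rw [this, add_zero]
  refine Finset.sum_congr rfl fun l hl => ?_
  have hl : l ≤ n := by have := Finset.mem_range.1 hl; omega
  obtain ⟨k, rfl⟩ := Nat.exists_eq_add_of_le hl
  have h1 : l + k + 1 - l = k + 1 := by omega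
  have h2 : l + k - l = k := by omega
  rw [derivative_C_mul_X_pow, h1, h2, Nat.add_sub_cancel, ← mul_assoc (C ((l + k + 1 : ℕ) : ℝ)), ← C_mul]
  congr 2
  rw [Nat.factorial_succ (l + k), Nat.factorial_succ k]
  have := Nat.factorial_ne_zero
  push_cast
  have : (k : ℝ) + 1 ≠ 0 := by positivity
  field_simp

/-! ### Matchings and their averages over random permutations -/

/-- The matchings of the complete bipartite graph between `A` and `B`. -/
def matchings {α : Type*} [DecidableEq α] (A B : Finset α) : Finset (Finset (α × α)) :=
  {M ∈ (A ×ˢ B).powerset | Set.InjOn Prod.fst (M : Set (α × α)) ∧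
    Set.InjOn Prod.snd (M : Set (α × α))}

section Matching

variable {α : Type*} [DecidableEq α]

lemma mem_matchings {A B : Finset α} {M : Finset (α × α)} : M ∈ matchings A B ↔
    M ⊆ A ×ˢ B ∧ Set.InjOn Prod.fst (M : Set (α × α)) ∧ Set.InjOn Prod.snd (M : Set (α × α)) := by
  rw [matchings, Finset.mem_filter, Finset.mem_powerset]

lemma empty_mem_matchings (A B : Finset α) : ∅ ∈ matchings A B := by simp [mem_matchings]

/-- A matching leaves `a` uncovered or uses exactly one edge at `a`. This drives both the
enumeration of matchings and the recurrence for `matchingPoly`. -/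
lemma matchings_insert {A B : Finset α} {a : α} (ha : a ∉ A) :
    matchings (insert a A) B = matchings A B ∪
      B.biUnion fun b => (matchings A (B.erase b)).image fun M => insert (a, b) M := by
  ext M
  simp only [Finset.mem_union, Finset.mem_biUnion, Finset.mem_image]
  constructor
  · intro hM
    obtain ⟨h1, h2, h3⟩ := mem_matchings.1 hM
    by_cases h : ∃ b, (a, b) ∈ M
    · obtain ⟨b, hb⟩ := h
      refine Or.inr ⟨b, (Finset.mem_product.1 (h1 hb)).2, M.erase (a, b), ?_,
        Finset.insert_erase hb⟩
      have hsub : (↑(M.erase (a, b)) : Set (α × α)) ⊆ M := by simp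
      refine mem_matchings.2 ⟨fun e he => ?_, h2.mono hsub, h3.mono hsub⟩
      obtain ⟨hne, heM⟩ := Finset.mem_erase.1 he
      have heAB := Finset.mem_product.1 (h1 heM)
      refine Finset.mem_product.2 ⟨?_, Finset.mem_erase.2 ⟨fun h => hne (h3 heM hb h), heAB.2⟩⟩
      exact (Finset.mem_insert.1 heAB.1).resolve_left fun h => hne (h2 heM hb h)
    · refine Or.inl (mem_matchings.2 ⟨fun e he => ?_, h2, h3⟩)
      have heAB := Finset.mem_product.1 (h1 he)
      refine Finset.mem_product.2 ⟨(Finset.mem_insert.1 heAB.1).resolve_left fun h' =>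
        h ⟨e.2, ?_⟩, heAB.2⟩
      rwa [← h']
  · rintro (hM | ⟨b, hb, M, hM, rfl⟩)
    · obtain ⟨h1, h2, h3⟩ := mem_matchings.1 hM
      exact mem_matchings.2 ⟨h1.trans (Finset.product_subset_product_left
        (Finset.subset_insert a A)), h2, h3⟩
    · obtain ⟨h1, h2, h3⟩ := mem_matchings.1 hM
      refine mem_matchings.2 ⟨?_, ?_, ?_⟩
      · intro e he
        rcases Finset.mem_insert.1 he with rfl | he
        · simp [hb]
        · have := Finset.mem_product.1 (h1 he)
          exact Finset.mem_product.2 ⟨Finset.mem_insert_of_mem this.1,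
            Finset.mem_of_mem_erase this.2⟩
      · rw [Finset.coe_insert, Set.injOn_insert]
        · refine ⟨h2, ?_⟩
          rintro ⟨e, he, hea⟩
          exact ha (by simpa [hea] using (Finset.mem_product.1 (h1 he)).1)
        · exact fun h => ha (Finset.mem_product.1 (h1 h)).1
      · rw [Finset.coe_insert, Set.injOn_insert]
        · refine ⟨h3, ?_⟩
          rintro ⟨e, he, heb⟩
          exact Finset.ne_of_mem_erase (Finset.mem_product.1 (h1 he)).2 heb
        · exact fun h => ha (Finset.mem_product.1 (h1 h)).1

lemma notMem_of_mem_matchings {A B : Finset α} {a b : α} (ha : a ∉ A) {M : Finset (α × α)}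
    (hM : M ∈ matchings A B) : (a, b) ∉ M :=
  fun h => ha (Finset.mem_product.1 ((mem_matchings.1 hM).1 h)).1

lemma sum_matchings_insert {A B : Finset α} {a : α} (ha : a ∉ A) (g : Finset (α × α) → ℝ) :
    ∑ M ∈ matchings (insert a A) B, g M = ∑ M ∈ matchings A B, g M +
      ∑ b ∈ B, ∑ M ∈ matchings A (B.erase b), g (insert (a, b) M) := by
  rw [matchings_insert ha, Finset.sum_union, Finset.sum_biUnion]
  · congr 1
    refine Finset.sum_congr rfl fun b _ => ?_
    rw [Finset.sum_image]
    intro M hM N hN h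
    dsimp only at h
    rw [← Finset.erase_insert (notMem_of_mem_matchings (b := b) ha hM), h,
      Finset.erase_insert (notMem_of_mem_matchings ha hN)]
  · intro b _ b' _ hbb'
    refine Finset.disjoint_left.2 fun M hM hM' => hbb' ?_
    obtain ⟨N, hN, rfl⟩ := Finset.mem_image.1 hM
    obtain ⟨N', hN', h⟩ := Finset.mem_image.1 hM'
    have : (a, b') ∈ insert (a, b) N := h ▸ Finset.mem_insert_self _ _
    rcases Finset.mem_insert.1 this with h | h
    · exact (Prod.mk.inj h).2.symm
    · exact absurd h (notMem_of_mem_matchings ha hN)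
  · refine Finset.disjoint_left.2 fun M hM hM' => ?_
    obtain ⟨b, _, hM'⟩ := Finset.mem_biUnion.1 hM'
    obtain ⟨N, hN, rfl⟩ := Finset.mem_image.1 hM'
    exact notMem_of_mem_matchings ha hM (Finset.mem_insert_self _ _)

lemma card_le_of_mem_matchings {A B : Finset α} {M : Finset (α × α)} (hM : M ∈ matchings A B) :
    M.card ≤ A.card ∧ M.card ≤ B.card := by
  obtain ⟨h1, h2, h3⟩ := mem_matchings.1 hM
  constructor
  · rw [← Finset.card_image_of_injOn h2]
    exact Finset.card_le_card (Finset.image_subset_iff.2 fun e he =>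
      (Finset.mem_product.1 (h1 he)).1)
  · rw [← Finset.card_image_of_injOn h3]
    exact Finset.card_le_card (Finset.image_subset_iff.2 fun e he =>
      (Finset.mem_product.1 (h1 he)).2)

/-- The number of matchings of size `i` between `A` and `B`. -/
lemma card_matchings_eq (A B : Finset α) (i : ℕ) :
    ((matchings A B).filter fun M => M.card = i).card =
      A.card.choose i * B.card.descFactorial i := by
  induction A using Finset.induction_on generalizing B i with
  | empty =>
    have : matchings (∅ : Finset α) B = {∅} := by
      ext M
      rw [mem_matchings, Finset.empty_product, Finset.subset_empty, Finset.mem_singleton]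
      refine ⟨fun h => h.1, ?_⟩
      rintro rfl
      simp
    rw [this, Finset.filter_singleton, Finset.card_empty, Finset.card_empty]
    rcases i with _ | i
    · simp
    · simp
  | insert a A ha ih =>
    -- Counting is summing an indicator, so the sum recursion applies; Pascal's rule then closes the
    -- induction.
    have hs := sum_matchings_insert (B := B) ha (fun M => if M.card = i then (1 : ℝ) else 0)
    rw [← Finset.sum_filter, ← Finset.sum_filter, Finset.sum_const, Finset.sum_const,
      nsmul_one, nsmul_one, ih] at hs
    rw [Finset.card_insert_of_notMem ha]
    rcases i with _ | i
    · have hz : ∑ b ∈ B, ∑ M ∈ matchings A (B.erase b),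
          (if (insert (a, b) M).card = 0 then (1 : ℝ) else 0) = 0 :=
        Finset.sum_eq_zero fun b _ => Finset.sum_eq_zero fun M _ => by simp
      rw [hz] at hs
      have hs' : ((((matchings (insert a A) B).filter fun M => M.card = 0).card : ℕ) : ℝ) =
        ((A.card.choose 0 * B.card.descFactorial 0 : ℕ) : ℝ) := by rw [hs]; simp
      rw [Nat.cast_inj.1 hs']
      simp
    · have hz : ∑ b ∈ B, ∑ M ∈ matchings A (B.erase b),
          (if (insert (a, b) M).card = i + 1 then (1 : ℝ) else 0) =
          ((B.card * (A.card.choose i * (B.card - 1).descFactorial i) : ℕ) : ℝ) := by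
        rw [Nat.cast_mul, ← nsmul_eq_mul, ← Finset.sum_const]
        refine Finset.sum_congr rfl fun b hb => ?_
        rw [← Finset.card_erase_of_mem hb, ← ih, ← nsmul_one, ← Finset.sum_const,
          Finset.sum_filter]
        refine Finset.sum_congr rfl fun M hM => ?_
        rw [Finset.card_insert_of_notMem (notMem_of_mem_matchings ha hM)]
        simp
      rw [hz, ← Nat.cast_add, Nat.cast_inj] at hs
      rw [hs, Nat.choose_succ_succ]
      rcases hB : B.card with _ | k
      · simp
      · rw [Nat.succ_descFactorial_succ, Nat.add_sub_cancel]
        ring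

/-- The number of permutations extending a partial matching. -/
lemma card_perm_extending [Fintype α] (M : Finset (α × α))
    (h1 : Set.InjOn Prod.fst (M : Set (α × α))) (h2 : Set.InjOn Prod.snd (M : Set (α × α))) :
    (Finset.univ.filter fun σ : Equiv.Perm α => ∀ e ∈ M, σ e.1 = e.2).card =
      (Fintype.card α - M.card)! := by
  obtain ⟨σ₀, hσ₀⟩ : ∃ σ₀ : Equiv.Perm α, ∀ e ∈ M, σ₀ e.1 = e.2 := by
    let f : α → α := fun a => if h : ∃ b, (a, b) ∈ M then h.choose else a
    have hf : ∀ e ∈ M, f e.1 = e.2 := by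
      intro e he
      have hex : ∃ b, (e.1, b) ∈ M := ⟨e.2, he⟩
      have : f e.1 = hex.choose := dif_pos hex
      rw [this]
      have := h1 hex.choose_spec he rfl
      exact (congrArg Prod.snd this :)
    have hinj : Set.InjOn f (M.image Prod.fst : Finset α) := by
      intro x hx y hy hxy
      obtain ⟨e, he, rfl⟩ := Finset.mem_image.1 (Finset.mem_coe.1 hx)
      obtain ⟨e', he', rfl⟩ := Finset.mem_image.1 (Finset.mem_coe.1 hy)
      rw [hf e he, hf e' he'] at hxy
      rw [h2 he he' hxy]
    obtain ⟨g, hg⟩ := Finset.exists_equiv_extend_of_card_eq (s := M.image Prod.fst)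
      (t := (Finset.univ : Finset α)) (by simp) (f := f) (by simp) hinj
    refine ⟨g.trans (Equiv.subtypeUnivEquiv (by simp)), fun e he => ?_⟩
    rw [← hf e he, ← hg e.1 (Finset.mem_image_of_mem _ he)]
    rfl
  -- Left multiplication by the inverse of one fixed extension σ₀ identifies the extensions of M
  -- with the permutations that fix its left endpoints.
  have e : {σ : Equiv.Perm α // ∀ e ∈ M, σ e.1 = e.2} ≃
      {τ : Equiv.Perm α // ∀ a, ¬ (a ∉ M.image Prod.fst) → τ a = a} :=
    { toFun := fun σ => ⟨σ₀⁻¹ * σ.1, fun a ha => by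
        obtain ⟨e, he, rfl⟩ := Finset.mem_image.1 (not_not.1 ha)
        rw [Equiv.Perm.mul_apply, σ.2 e he, ← hσ₀ e he, Equiv.Perm.inv_eq_iff_eq]⟩
      invFun := fun τ => ⟨σ₀ * τ.1, fun e he => by
        rw [Equiv.Perm.mul_apply, τ.2 e.1 (not_not.2 (Finset.mem_image_of_mem _ he)), hσ₀ e he]⟩
      left_inv := fun σ => by simp
      right_inv := fun τ => by simp }
  rw [← Fintype.card_subtype, Fintype.card_congr e, ← Fintype.card_congr
    (Equiv.Perm.subtypeEquivSubtypePerm fun a => a ∉ M.image Prod.fst), Fintype.card_perm,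
    Fintype.card_subtype_compl, Fintype.card_coe, Finset.card_image_of_injOn h1]

/-- The weighted number of perfect-or-partial matchings of size `j`. -/
def matchingSum [Fintype α] (W : α → α → ℝ) (j : ℕ) : ℝ :=
  ∑ M ∈ matchings (Finset.univ : Finset α) Finset.univ with M.card = j, ∏ e ∈ M, W e.1 e.2

/-- Removing N leaves an arbitrary matching of size i between the uncovered vertices, of which each
side has `Fintype.card α - N.card`. -/
lemma card_matchings_superset [Fintype α] {N : Finset (α × α)}
    (hN : N ∈ matchings (Finset.univ : Finset α) Finset.univ) (i : ℕ) :
    ((matchings (Finset.univ : Finset α) Finset.univ).filter fun M =>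
      M.card = N.card + i ∧ N ⊆ M).card =
      (Fintype.card α - N.card).choose i * (Fintype.card α - N.card).descFactorial i := by
  obtain ⟨-, hN1, hN2⟩ := mem_matchings.1 hN
  have c1 : (Finset.univ \ N.image Prod.fst).card = Fintype.card α - N.card := by
    rw [Finset.card_sdiff_of_subset (Finset.subset_univ _), Finset.card_image_of_injOn hN1,
      Finset.card_univ]
  have c2 : (Finset.univ \ N.image Prod.snd).card = Fintype.card α - N.card := by
    rw [Finset.card_sdiff_of_subset (Finset.subset_univ _), Finset.card_image_of_injOn hN2,
      Finset.card_univ]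
  have key := card_matchings_eq (Finset.univ \ N.image Prod.fst) (Finset.univ \ N.image Prod.snd) i
  rw [c1, c2] at key
  rw [← key]
  have hdisj : ∀ K ∈ matchings (Finset.univ \ N.image Prod.fst) (Finset.univ \ N.image Prod.snd),
      Disjoint N K := by
    intro K hK
    refine Finset.disjoint_left.2 fun e he heK => ?_
    have := (Finset.mem_product.1 ((mem_matchings.1 hK).1 heK)).1
    exact (Finset.mem_sdiff.1 this).2 (Finset.mem_image_of_mem _ he)
  refine Finset.card_bij' (fun M _ => M \ N) (fun K _ => N ∪ K) ?_ ?_ ?_ ?_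
  · intro M hM
    obtain ⟨hM, hcard, hsub⟩ := Finset.mem_filter.1 hM
    obtain ⟨-, h1, h2⟩ := mem_matchings.1 hM
    have hss : ((M \ N : Finset (α × α)) : Set (α × α)) ⊆ M := by simp
    refine Finset.mem_filter.2 ⟨mem_matchings.2 ⟨fun e he => ?_, h1.mono hss, h2.mono hss⟩, ?_⟩
    · obtain ⟨heM, heN⟩ := Finset.mem_sdiff.1 he
      refine Finset.mem_product.2 ⟨Finset.mem_sdiff.2 ⟨Finset.mem_univ _, fun h => ?_⟩,
        Finset.mem_sdiff.2 ⟨Finset.mem_univ _, fun h => ?_⟩⟩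
      · obtain ⟨e', he', h⟩ := Finset.mem_image.1 h
        exact heN (h1 (hsub he') heM h ▸ he')
      · obtain ⟨e', he', h⟩ := Finset.mem_image.1 h
        exact heN (h2 (hsub he') heM h ▸ he')
    · rw [Finset.card_sdiff_of_subset hsub, hcard, Nat.add_sub_cancel_left]
  · intro K hK
    obtain ⟨hK, hcard⟩ := Finset.mem_filter.1 hK
    have hd := hdisj K hK
    obtain ⟨hs, h1, h2⟩ := mem_matchings.1 hK
    refine Finset.mem_filter.2 ⟨mem_matchings.2 ⟨by simp, ?_, ?_⟩, ?_, Finset.subset_union_left⟩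
    · rw [Finset.coe_union, Set.injOn_union (by exact_mod_cast hd)]
      refine ⟨hN1, h1, fun e he e' he' h => ?_⟩
      have := (Finset.mem_product.1 (hs he')).1
      exact (Finset.mem_sdiff.1 this).2 (h ▸ Finset.mem_image_of_mem _ he)
    · rw [Finset.coe_union, Set.injOn_union (by exact_mod_cast hd)]
      refine ⟨hN2, h2, fun e he e' he' h => ?_⟩
      have := (Finset.mem_product.1 (hs he')).2
      exact (Finset.mem_sdiff.1 this).2 (h ▸ Finset.mem_image_of_mem _ he)
    · rw [Finset.card_union_of_disjoint hd, hcard]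
  · intro M hM
    exact Finset.union_sdiff_of_subset (Finset.mem_filter.1 hM).2.2
  · intro K hK
    exact Finset.union_sdiff_cancel_left (hdisj K (Finset.mem_filter.1 hK).1)

/-- On the left, the permutations containing i prescribed edges times the ways to add i edges to a
smaller matching; on the right, the factor that one convolution step contributes. -/
lemma factorial_mul_choose_mul_descFactorial (m k i : ℕ) (hk : k ≤ m) :
    ((m - i)! : ℝ) * ((k.choose i * k.descFactorial i : ℕ) : ℝ) =
      (m ! : ℝ) * ((k.choose i : ℝ) ^ 2 / (m.choose i : ℝ)) := by
  rcases le_or_gt i k with hi | hi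
  · have h := Nat.choose_mul_factorial_mul_factorial (hi.trans hk)
    have h' : ((m.choose i : ℝ)) * (i ! : ℝ) * ((m - i)! : ℝ) = (m ! : ℝ) := by exact_mod_cast h
    have hc : (m.choose i : ℝ) ≠ 0 := by exact_mod_cast (Nat.choose_pos (hi.trans hk)).ne'
    rw [Nat.descFactorial_eq_factorial_mul_choose, ← h']
    push_cast
    field_simp
  · simp [Nat.choose_eq_zero_of_lt hi]

/-- Averaging over the addition of a uniformly random perfect matching. -/
lemma sum_perm_matchingSum [Fintype α] (W : α → α → ℝ) (l : ℕ) :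
    ∑ σ : Equiv.Perm α, matchingSum (fun a b => W a b + if σ a = b then 1 else 0) l =
      ((Fintype.card α)! : ℝ) * ∑ ji ∈ Finset.HasAntidiagonal.antidiagonal l, matchingSum W ji.1 *
        (((Fintype.card α - ji.1).choose ji.2 : ℝ) ^ 2 /
          ((Fintype.card α).choose ji.2 : ℝ)) := by
  set m := Fintype.card α with hm
  set U : Finset (Finset (α × α)) := matchings Finset.univ Finset.univ with hU
  set w : Finset (α × α) → ℝ := fun N => ∏ e ∈ N, W e.1 e.2 with hw
  have hsub : ∀ M ∈ U, ∀ N ⊆ M, N ∈ U := by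
    intro M hM N hN
    obtain ⟨h1, h2, h3⟩ := mem_matchings.1 hM
    exact mem_matchings.2 ⟨hN.trans h1, h2.mono (by exact_mod_cast hN),
      h3.mono (by exact_mod_cast hN)⟩
  -- Expanding the product over M chooses the set N of edges taken from W; the other l - |N| edges
  -- must lie in σ, which leaves (m - (l - |N|))! permutations.
  have step1 : ∑ σ : Equiv.Perm α, matchingSum (fun a b => W a b + if σ a = b then 1 else 0) l =
      ∑ M ∈ U with M.card = l, ∑ N ∈ M.powerset, w N * ((m - (l - N.card))! : ℝ) := by
    simp only [matchingSum]
    rw [Finset.sum_comm]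
    refine Finset.sum_congr rfl fun M hM => ?_
    obtain ⟨hM, hcard⟩ := Finset.mem_filter.1 hM
    simp only [Finset.prod_add]
    rw [Finset.sum_comm]
    refine Finset.sum_congr rfl fun N hN => ?_
    have hN := Finset.mem_powerset.1 hN
    rw [← Finset.mul_sum]
    congr 1
    have hboole : ∀ σ : Equiv.Perm α, (∏ e ∈ M \ N, if σ e.1 = e.2 then (1 : ℝ) else 0) =
        if ∀ e ∈ M \ N, σ e.1 = e.2 then 1 else 0 := fun σ => by
      rw [Finset.prod_boole]
      congr
    simp only [hboole]
    obtain ⟨-, h2, h3⟩ := mem_matchings.1 (hsub M hM (M \ N) Finset.sdiff_subset)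
    rw [Finset.sum_boole, card_perm_extending (M \ N) h2 h3, Finset.card_sdiff_of_subset hN, hcard]
  -- With N summed first, the inner sum only counts the matchings containing N.
  have step2 : ∑ M ∈ U with M.card = l, ∑ N ∈ M.powerset, w N * ((m - (l - N.card))! : ℝ) =
      ∑ N ∈ U with N.card ≤ l, ∑ M ∈ U with M.card = l ∧ N ⊆ M,
        w N * ((m - (l - N.card))! : ℝ) := by
    refine Finset.sum_comm' fun M N => ?_
    simp only [Finset.mem_filter, Finset.mem_powerset]
    constructor
    · rintro ⟨⟨h1, h2⟩, h3⟩
      exact ⟨⟨h1, h2, h3⟩, hsub M h1 N h3, h2 ▸ Finset.card_le_card h3⟩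
    · rintro ⟨⟨h1, h2, h3⟩, -, -⟩
      exact ⟨⟨h1, h2⟩, h3⟩
  rw [step1, step2, Finset.Nat.sum_antidiagonal_eq_sum_range_succ (fun j i => matchingSum W j *
    (((m - j).choose i : ℝ) ^ 2 / (m.choose i : ℝ))), Finset.mul_sum,
    ← Finset.sum_fiberwise_of_maps_to (s := {N ∈ U | N.card ≤ l}) (t := Finset.range (l + 1))
      (g := Finset.card) (fun N hN => by
        have := (Finset.mem_filter.1 hN).2
        exact Finset.mem_range.2 (by omega))]
  refine Finset.sum_congr rfl fun j hj => ?_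
  have hj : j ≤ l := by have := Finset.mem_range.1 hj; omega
  rw [matchingSum, Finset.sum_mul, Finset.mul_sum]
  have hset : ({N ∈ {N ∈ U | N.card ≤ l} | N.card = j} : Finset _) = {N ∈ U | N.card = j} := by
    ext N
    simp only [Finset.mem_filter]
    constructor
    · rintro ⟨⟨h1, -⟩, h2⟩
      exact ⟨h1, h2⟩
    · rintro ⟨h1, h2⟩
      exact ⟨⟨h1, h2 ▸ hj⟩, h2⟩
  rw [hset]
  refine Finset.sum_congr rfl fun N hN => ?_
  obtain ⟨hN, hcard⟩ := Finset.mem_filter.1 hN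
  have h1 := card_matchings_superset hN (l - j)
  rw [hcard, Nat.add_sub_of_le hj] at h1
  rw [Finset.sum_const, h1, nsmul_eq_mul, hcard]
  have h2 := factorial_mul_choose_mul_descFactorial m (m - j) (l - j) (Nat.sub_le m j)
  linear_combination w N * h2

/-- The weight matrix of a sum of permutation matrices. -/
def permSum {d : ℕ} (σ : Fin d → Equiv.Perm α) (a b : α) : ℝ :=
  ∑ k, if σ k a = b then 1 else 0

/-- These are the unsigned coefficients of `powPoly m m d 1` times the number of d-tuples: averaging
over each new permutation contributes one factor `genSeries`. -/
lemma sum_matchingSum_permSum [Fintype α] (d j : ℕ) (hj : j ≤ Fintype.card α) :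
    ∑ σ : Fin d → Equiv.Perm α, matchingSum (permSum σ) j =
      ((Fintype.card α)! : ℝ) ^ d *
        (((Fintype.card α)! : ℝ) * ((Fintype.card α)! : ℝ) /
          (((Fintype.card α - j)! : ℝ) * ((Fintype.card α - j)! : ℝ)) *
          PowerSeries.coeff j (genSeries (Fintype.card α) ^ d)) := by
  have hfac := Nat.factorial_ne_zero
  induction d generalizing j with
  | zero =>
    rw [Fintype.sum_unique, pow_zero, pow_zero, one_mul, PowerSeries.coeff_one, matchingSum]
    split_ifs with h0
    · subst h0
      have : ((matchings (Finset.univ : Finset α) Finset.univ).filter fun M => M.card = 0) = {∅} := by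
        ext M
        simp only [Finset.mem_filter, Finset.card_eq_zero, Finset.mem_singleton]
        exact ⟨fun h => h.2, fun h => ⟨h ▸ empty_mem_matchings _ _, h⟩⟩
      rw [this, Finset.sum_singleton, Finset.prod_empty, Nat.sub_zero, mul_one, div_self]
      have := hfac (Fintype.card α)
      positivity
    · rw [mul_zero]
      refine Finset.sum_eq_zero fun M hM => ?_
      obtain ⟨e, he⟩ : M.Nonempty := Finset.card_pos.1 (by
        rw [(Finset.mem_filter.1 hM).2]; omega)
      exact Finset.prod_eq_zero he (by simp [permSum])
  | succ d ih =>
    rw [← (Fin.consEquiv fun _ => Equiv.Perm α).sum_comp, Fintype.sum_prod_type_right]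
    have hcons : ∀ (τ : Equiv.Perm α) (σ : Fin d → Equiv.Perm α),
        permSum ((Fin.consEquiv fun _ => Equiv.Perm α) (τ, σ)) =
          fun a b => permSum σ a b + if τ a = b then 1 else 0 := by
      intro τ σ
      ext a b
      simp [permSum, Fin.sum_univ_succ, Fin.consEquiv, add_comm]
    simp only [hcons, sum_perm_matchingSum]
    rw [← Finset.mul_sum, Finset.sum_comm, pow_succ, pow_succ, PowerSeries.coeff_mul,
      Finset.mul_sum, Finset.mul_sum, Finset.mul_sum]
    refine Finset.sum_congr rfl fun ji hji => ?_
    have hji := Finset.HasAntidiagonal.mem_antidiagonal.1 hji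
    rw [← Finset.sum_mul, ih _ (by omega), genSeries, PowerSeries.coeff_mk,
      Nat.cast_choose ℝ (show ji.2 ≤ Fintype.card α - ji.1 by omega),
      Nat.cast_choose ℝ (show ji.2 ≤ Fintype.card α by omega),
      show Fintype.card α - ji.1 - ji.2 = Fintype.card α - j by omega]
    field_simp

end Matching

/-! ### Derivatives of real-rooted polynomials and the barrier -/

/-- Rolle's theorem with multiplicities: differentiation loses at most one root, while the degree
drops by at least one. -/
lemma splits_derivative {p : ℝ[X]} (hp : p.Splits) : (derivative p).Splits := by
  rcases eq_or_ne p.natDegree 0 with h0 | h0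
  · rw [eq_C_of_natDegree_eq_zero h0, derivative_C]
    exact Splits.zero
  rw [splits_iff_card_roots] at hp ⊢
  have h1 := card_roots_le_derivative p
  have h2 := card_roots' (derivative p)
  have h3 := natDegree_derivative_lt h0
  omega

lemma eval_derivative_prod_X_sub_C (s : Multiset ℝ) (y : ℝ) (hy : ∀ a ∈ s, a < y) :
    (derivative (s.map fun a => X - C a).prod).eval y =
      (s.map fun a => X - C a).prod.eval y * (s.map fun a => (y - a)⁻¹).sum := by
  induction s using Multiset.induction with
  | empty => simp
  | cons a s ih =>
    have ih := ih fun b hb => hy b (Multiset.mem_cons_of_mem hb)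
    have ha : y - a ≠ 0 := (sub_pos.2 (hy a (Multiset.mem_cons_self a s))).ne'
    simp only [Multiset.map_cons, Multiset.prod_cons, Multiset.sum_cons, derivative_mul,
      derivative_sub, derivative_X, derivative_C, eval_add, eval_mul, eval_sub, eval_X, eval_C,
      eval_one, eval_zero, ih]
    field_simp
    ring

/-- This is p''/p = (p'/p)² + (p'/p)'. -/
lemma eval_derivative_derivative_prod_X_sub_C (s : Multiset ℝ) (y : ℝ) (hy : ∀ a ∈ s, a < y) :
    (derivative (derivative (s.map fun a => X - C a).prod)).eval y =
      (s.map fun a => X - C a).prod.eval y *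
        ((s.map fun a => (y - a)⁻¹).sum ^ 2 - (s.map fun a => (y - a)⁻¹ ^ 2).sum) := by
  induction s using Multiset.induction with
  | empty => simp
  | cons a s ih =>
    have hs : ∀ b ∈ s, b < y := fun b hb => hy b (Multiset.mem_cons_of_mem hb)
    have ih := ih hs
    have h1 := eval_derivative_prod_X_sub_C s y hs
    have ha : y - a ≠ 0 := (sub_pos.2 (hy a (Multiset.mem_cons_self a s))).ne'
    simp only [Multiset.map_cons, Multiset.prod_cons, Multiset.sum_cons, derivative_mul,
      derivative_sub, derivative_X, derivative_C, eval_add, eval_mul, eval_sub, eval_X, eval_C,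
      eval_one, eval_zero, derivative_add, derivative_one, derivative_zero, ih, h1]
    field_simp
    ring

/-- If `∑ u / (1 + u) ≤ 1` then `(∑ u)² ≤ ∑ (u + u²)`. -/
lemma sum_sq_le_of_sum_div_le_one (s : Multiset ℝ) (hs : ∀ u ∈ s, 0 ≤ u)
    (h : (s.map fun u => u / (1 + u)).sum ≤ 1) :
    s.sum ^ 2 ≤ s.sum + (s.map fun u => u ^ 2).sum := by
  -- Cauchy–Schwarz applied to u² = (u/(1+u)) · (u+u²), in a form that an induction can prove.
  have key : ∀ t : Multiset ℝ, (∀ u ∈ t, 0 ≤ u) → t.sum ^ 2 ≤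
      (t.map fun u => u / (1 + u)).sum * (t.sum + (t.map fun u => u ^ 2).sum) ∧
      0 ≤ t.sum ∧ 0 ≤ (t.map fun u => u ^ 2).sum ∧ 0 ≤ (t.map fun u => u / (1 + u)).sum := by
    intro t
    induction t using Multiset.induction with
    | empty => simp
    | cons a t ih =>
      intro ht
      obtain ⟨h1, h2, h3, h4⟩ := ih fun u hu => ht u (Multiset.mem_cons_of_mem hu)
      have ha := ht a (Multiset.mem_cons_self a t)
      simp only [Multiset.map_cons, Multiset.sum_cons]
      set S := t.sum
      set Q := (t.map fun u => u ^ 2).sum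
      set R := (t.map fun u => u / (1 + u)).sum
      have h5 : a / (1 + a) * (a + a ^ 2) = a ^ 2 := by field_simp
      refine ⟨?_, by positivity, by positivity, by positivity⟩
      -- AM–GM on the cross terms: their product is a²R(S+Q), which is at least a²S² by induction.
      have h6 : 2 * a * S ≤ a / (1 + a) * (S + Q) + R * (a + a ^ 2) := by
        have hV : 0 ≤ a / (1 + a) * (S + Q) := by positivity
        have hW : 0 ≤ R * (a + a ^ 2) := by positivity
        have : (2 * a * S) ^ 2 ≤ (a / (1 + a) * (S + Q) + R * (a + a ^ 2)) ^ 2 := by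
          have e : a / (1 + a) * (S + Q) * (R * (a + a ^ 2)) = a ^ 2 * (R * (S + Q)) := by
            linear_combination (S + Q) * R * h5
          have e2 : a ^ 2 * S ^ 2 ≤ a ^ 2 * (R * (S + Q)) := by gcongr
          nlinarith [sq_nonneg (a / (1 + a) * (S + Q) - R * (a + a ^ 2))]
        exact abs_le_of_sq_le_sq' this (by positivity) |>.2
      nlinarith
  obtain ⟨h1, h2, h3, h4⟩ := key s hs
  nlinarith

/-- Moving the barrier point by `δ` when passing to the derivative. -/
lemma barrier_derivative {p : ℝ[X]} (hp : p.Splits) (hm : p.Monic) (hdeg : 2 ≤ p.natDegree)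
    {b δ : ℝ} (hδ : 0 ≤ δ) (hb : ∀ a, p.eval a = 0 → a < b)
    (h : δ * (derivative p).eval b ≤ p.eval b) :
    (∀ a, (derivative p).eval a = 0 → a < b - δ) ∧
      δ * (derivative (derivative p)).eval (b - δ) ≤ (derivative p).eval (b - δ) := by
  have hp0 : p ≠ 0 := hm.ne_zero
  have hprod := hp.eq_prod_roots_of_monic hm
  have hmem : ∀ a, a ∈ p.roots ↔ p.eval a = 0 := fun a => by rw [mem_roots hp0, IsRoot]
  have hpos : ∀ y : ℝ, (∀ a ∈ p.roots, a < y) → 0 < p.eval y := by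
    intro y hy
    rw [hprod, eval_multiset_prod, Multiset.map_map]
    refine Multiset.prod_pos fun c hc => ?_
    obtain ⟨a, ha, rfl⟩ := Multiset.mem_map.1 hc
    simpa using hy a ha
  have hbr : ∀ a ∈ p.roots, a < b := fun a ha => hb a ((hmem a).1 ha)
  have hsum : δ * (p.roots.map fun a => (b - a)⁻¹).sum ≤ 1 := by
    have e := eval_derivative_prod_X_sub_C p.roots b hbr
    rw [← hprod] at e
    rw [e] at h
    have := hpos b hbr
    by_contra! hc
    nlinarith
  -- A second root contributes a positive term to the barrier sum, so δ/(b-a) < 1 strictly. This is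
  -- where degree at least two matters.
  have hlt : ∀ a ∈ p.roots, a < b - δ := by
    intro a ha
    rcases hδ.eq_or_lt with h0 | h0
    · simpa [← h0] using hbr a ha
    obtain ⟨t, ht⟩ := Multiset.exists_cons_of_mem ha
    have hcard : Multiset.card p.roots = p.natDegree := splits_iff_card_roots.1 hp
    have htne : t ≠ 0 := by
      rintro rfl
      rw [ht] at hcard
      simp at hcard
      omega
    obtain ⟨c, hc⟩ := Multiset.exists_mem_of_ne_zero htne
    obtain ⟨t', ht'⟩ := Multiset.exists_cons_of_mem hc
    rw [ht, ht'] at hsum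
    simp only [Multiset.map_cons, Multiset.sum_cons] at hsum
    have hcb : 0 < (b - c)⁻¹ :=
      inv_pos.2 (sub_pos.2 (hbr c (by rw [ht, ht']; simp)))
    have hrest : 0 ≤ (t'.map fun a => (b - a)⁻¹).sum := by
      refine Multiset.sum_nonneg fun u hu => ?_
      obtain ⟨e, he, rfl⟩ := Multiset.mem_map.1 hu
      exact inv_nonneg.2 (sub_pos.2 (hbr e (by rw [ht, ht']; simp [he]))).le
    have hab : 0 < b - a := sub_pos.2 (hbr a ha)
    have h1 : δ * (b - a)⁻¹ < 1 := by nlinarith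
    rw [← div_eq_mul_inv, div_lt_one hab] at h1
    linarith
  refine ⟨fun y hy => ?_, ?_⟩
  · by_contra! hle
    have hly : ∀ a ∈ p.roots, a < y := fun a ha => (hlt a ha).trans_le hle
    have e := eval_derivative_prod_X_sub_C p.roots y hly
    rw [← hprod, hy] at e
    have hne : p.roots ≠ 0 := fun h0 => by
      have hcard := splits_iff_card_roots.1 hp
      rw [h0, Multiset.card_zero] at hcard
      omega
    obtain ⟨a, ha⟩ := Multiset.exists_mem_of_ne_zero hne
    obtain ⟨t, ht⟩ := Multiset.exists_cons_of_mem ha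
    have hS : 0 < (p.roots.map fun a => (y - a)⁻¹).sum := by
      rw [ht, Multiset.map_cons, Multiset.sum_cons]
      refine add_pos_of_pos_of_nonneg (inv_pos.2 (sub_pos.2 (hly a ha)))
        (Multiset.sum_nonneg fun u hu => ?_)
      obtain ⟨c, hc, rfl⟩ := Multiset.mem_map.1 hu
      exact inv_nonneg.2 (sub_pos.2 (hly c (by rw [ht]; simp [hc]))).le
    exact (mul_pos (hpos y hly) hS).ne e
  have e1 := eval_derivative_prod_X_sub_C p.roots (b - δ) hlt
  have e2 := eval_derivative_derivative_prod_X_sub_C p.roots (b - δ) hlt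
  rw [← hprod] at e1 e2
  rw [e1, e2]
  have hP := hpos (b - δ) hlt
  set S := (p.roots.map fun a => (b - δ - a)⁻¹).sum with hS
  set Q := (p.roots.map fun a => (b - δ - a)⁻¹ ^ 2).sum with hQ
  rcases hδ.eq_or_lt with h0 | h0
  · have : 0 ≤ S := by
      refine Multiset.sum_nonneg fun u hu => ?_
      obtain ⟨e, he, rfl⟩ := Multiset.mem_map.1 hu
      exact inv_nonneg.2 (sub_pos.2 (hlt e he)).le
    rw [mul_eq_zero_of_left h0.symm]
    positivity
  -- For u = δ/(b-δ-a) one has u/(1+u) = δ/(b-a), so the barrier hypothesis at b is the required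
  -- bound; the conclusion reads δ(S² - Q) ≤ S, the barrier for p' at b-δ.
  have main := sum_sq_le_of_sum_div_le_one (p.roots.map fun a => δ * (b - δ - a)⁻¹) ?_ ?_
  · rw [Multiset.map_map, Multiset.sum_map_mul_left] at main
    have e3 : (p.roots.map ((fun u => u ^ 2) ∘ fun a => δ * (b - δ - a)⁻¹)).sum = δ ^ 2 * Q := by
      rw [hQ, ← Multiset.sum_map_mul_left]
      congr 1
      refine Multiset.map_congr rfl fun a _ => ?_
      simp only [Function.comp, mul_pow]
    rw [e3, ← hS] at main
    have : δ * (S ^ 2 - Q) ≤ S := by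
      by_contra! hc
      nlinarith
    nlinarith
  · intro u hu
    obtain ⟨a, ha, rfl⟩ := Multiset.mem_map.1 hu
    exact mul_nonneg hδ (inv_nonneg.2 (sub_pos.2 (hlt a ha)).le)
  · rw [Multiset.map_map]
    refine le_trans (le_of_eq ?_) hsum
    rw [← Multiset.sum_map_mul_left]
    congr 1
    refine Multiset.map_congr rfl fun a ha => ?_
    have h1 : 0 < b - δ - a := sub_pos.2 (hlt a ha)
    have h2 : 0 < b - a := sub_pos.2 (hbr a ha)
    simp only [Function.comp]
    have h3 : 1 + δ * (b - δ - a)⁻¹ = (b - a) * (b - δ - a)⁻¹ := by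
      field_simp
      ring
    rw [h3]
    field_simp

/-! ### Heilmann–Lieb estimates for matching polynomials -/

section HeilmannLieb

variable {α : Type*}

/-- All row and column sums are at most `D`, and nonzero weights are at least one. -/
structure DegreeLE [Fintype α] (W : α → α → ℝ) (D : ℝ) : Prop where
  zero_or_one_le : ∀ a b, W a b = 0 ∨ 1 ≤ W a b
  row : ∀ a, ∑ b, W a b ≤ D
  col : ∀ b, ∑ a, W a b ≤ D

namespace DegreeLE

variable [Fintype α] {W : α → α → ℝ} {D : ℝ}

lemma transpose (h : DegreeLE W D) : DegreeLE (fun a b => W b a) D :=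
  ⟨fun a b => h.1 b a, h.3, h.2⟩

lemma nonneg (h : DegreeLE W D) (a b : α) : 0 ≤ W a b := by
  rcases h.1 a b with h | h <;> linarith

lemma sum_le (h : DegreeLE W D) (a : α) (B : Finset α) : ∑ b ∈ B, W a b ≤ D :=
  (Finset.sum_le_sum_of_subset_of_nonneg (Finset.subset_univ B) fun b _ _ => h.nonneg a b).trans
    (h.2 a)

end DegreeLE

variable [DecidableEq α]

/-- The matching polynomial of the weighted bipartite graph `W` restricted to `A` and `B`. -/
def matchingPoly (W : α → α → ℝ) (A B : Finset α) (x : ℝ) : ℝ :=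
  ∑ M ∈ matchings A B, (-1) ^ M.card * (∏ e ∈ M, W e.1 e.2) * x ^ (A.card + B.card - 2 * M.card)

/-- The Heilmann–Lieb recurrence: matchings are sorted by the partner of `a`. -/
lemma matchingPoly_eq_sub (W : α → α → ℝ) {A : Finset α} (B : Finset α) (x : ℝ) {a : α}
    (ha : a ∈ A) : matchingPoly W A B x = x * matchingPoly W (A.erase a) B x -
      ∑ b ∈ B, W a b * matchingPoly W (A.erase a) (B.erase b) x := by
  have hna := Finset.notMem_erase a A
  have hcard := Finset.card_erase_add_one ha
  conv_lhs => rw [matchingPoly, ← Finset.insert_erase ha]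
  rw [sum_matchings_insert hna, Finset.insert_erase ha, sub_eq_add_neg, matchingPoly,
    Finset.mul_sum, ← Finset.sum_neg_distrib]
  congr 1
  · refine Finset.sum_congr rfl fun M hM => ?_
    have := card_le_of_mem_matchings hM
    rw [show A.card + B.card - 2 * M.card = (A.erase a).card + B.card - 2 * M.card + 1 by omega,
      pow_succ]
    ring
  · refine Finset.sum_congr rfl fun b hb => ?_
    rw [matchingPoly, Finset.mul_sum, ← Finset.sum_neg_distrib]
    refine Finset.sum_congr rfl fun M hM => ?_
    have hnM : (a, b) ∉ M := notMem_of_mem_matchings hna hM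
    have hcb := Finset.card_erase_add_one hb
    rw [Finset.card_insert_of_notMem hnM, Finset.prod_insert hnM,
      show A.card + B.card - 2 * (M.card + 1) =
        (A.erase a).card + (B.erase b).card - 2 * M.card by omega]
    ring

/-- Lets the Heilmann–Lieb induction pass from a vertex of A to its neighbours in B. -/
lemma matchingPoly_transpose (W : α → α → ℝ) (A B : Finset α) (x : ℝ) :
    matchingPoly W A B x = matchingPoly (fun a b => W b a) B A x := by
  have hmem : ∀ {A B : Finset α} {M : Finset (α × α)}, M ∈ matchings A B →
      M.map (Equiv.prodComm α α).toEmbedding ∈ matchings B A := by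
    intro A B M hM
    obtain ⟨h1, h2, h3⟩ := mem_matchings.1 hM
    refine mem_matchings.2 ⟨fun e he => ?_, ?_, ?_⟩
    · obtain ⟨e', he', rfl⟩ := Finset.mem_map.1 he
      have := Finset.mem_product.1 (h1 he')
      exact Finset.mem_product.2 ⟨this.2, this.1⟩
    · intro e he f hf h
      obtain ⟨e', he', rfl⟩ := Finset.mem_map.1 (Finset.mem_coe.1 he)
      obtain ⟨f', hf', rfl⟩ := Finset.mem_map.1 (Finset.mem_coe.1 hf)
      rw [h3 he' hf' h]
    · intro e he f hf h
      obtain ⟨e', he', rfl⟩ := Finset.mem_map.1 (Finset.mem_coe.1 he)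
      obtain ⟨f', hf', rfl⟩ := Finset.mem_map.1 (Finset.mem_coe.1 hf)
      rw [h2 he' hf' h]
  have hinv : ∀ M : Finset (α × α), (M.map (Equiv.prodComm α α).toEmbedding).map
      (Equiv.prodComm α α).toEmbedding = M := by
    intro M
    rw [Finset.map_map]
    convert Finset.map_refl
    ext e <;> rfl
  rw [matchingPoly, matchingPoly]
  refine Finset.sum_bij' (fun M _ => M.map (Equiv.prodComm α α).toEmbedding)
    (fun M _ => M.map (Equiv.prodComm α α).toEmbedding) (fun M hM => hmem hM)
    (fun M hM => hmem hM) (fun M _ => hinv M) (fun M _ => hinv M) fun M _ => ?_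
  rw [Finset.card_map, Finset.prod_map, add_comm A.card]
  rfl

lemma matchingPoly_empty (W : α → α → ℝ) (B : Finset α) (x : ℝ) :
    matchingPoly W ∅ B x = x ^ B.card := by
  have : matchings (∅ : Finset α) B = {∅} := by
    ext M
    rw [mem_matchings, Finset.empty_product, Finset.subset_empty, Finset.mem_singleton]
    exact ⟨fun h => h.1, by rintro rfl; simp⟩
  simp [matchingPoly, this]

/-- The Heilmann–Lieb estimates, to the right of the spectral radius of the `D`-regular tree. -/
theorem matchingPoly_estimates [Fintype α] {D t x : ℝ} (hD : 1 ≤ D) (ht : 0 < t) (ht1 : t < 1)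
    (hx : (D - 1) * t + 1 / t ≤ x) (N : ℕ) :
    ∀ (W : α → α → ℝ) (A B : Finset α), DegreeLE W D → A.card + B.card = N →
      0 < matchingPoly W A B x ∧ ∀ a ∈ A,
        (x - D * t) * matchingPoly W (A.erase a) B x ≤ matchingPoly W A B x ∧
        (∑ b ∈ B, W a b ≤ D - 1 →
          matchingPoly W (A.erase a) B x ≤ t * matchingPoly W A B x) := by
  have ht' : 1 < 1 / t := by rw [lt_div_iff₀ ht]; linarith
  have hx0 : 0 < x := by nlinarith [mul_nonneg (sub_nonneg.2 hD) ht.le]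
  have hxD : 0 < x - D * t := by nlinarith
  induction N using Nat.strong_induction_on with
  | _ N ih =>
    intro W A B hW hN
    -- If deleting a neighbour b costs a ratio at most t, the recurrence gives this bound. For
    -- degree at most D-1 the factor is at least x - (D-1)t ≥ 1/t, which reproduces the ratio t and
    -- closes the induction.
    have main : ∀ a ∈ A, 0 < matchingPoly W (A.erase a) B x ∧
        (x - (∑ b ∈ B, W a b) * t) * matchingPoly W (A.erase a) B x ≤ matchingPoly W A B x := by
      intro a ha
      have hcard := Finset.card_erase_add_one ha
      have hpos := (ih ((A.erase a).card + B.card) (by omega) W (A.erase a) B hW rfl).1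
      refine ⟨hpos, ?_⟩
      have hle : ∑ b ∈ B, W a b * matchingPoly W (A.erase a) (B.erase b) x ≤
          ∑ b ∈ B, W a b * (t * matchingPoly W (A.erase a) B x) := by
        refine Finset.sum_le_sum fun b hb => ?_
        -- A nonzero weight is at least 1, so once `a` is erased the neighbour b has degree at most
        -- D-1 and the ratio estimate applies to it.
        rcases hW.1 a b with h0 | h1
        · simp [h0]
        refine mul_le_mul_of_nonneg_left ?_ (hW.nonneg a b)
        have h2 := ((ih (B.card + (A.erase a).card) (by omega) (fun a b => W b a) B (A.erase a)
          hW.transpose rfl).2 b hb).2 ?_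
        · rwa [← matchingPoly_transpose W (A.erase a) (B.erase b),
            ← matchingPoly_transpose W (A.erase a) B] at h2
        · have h3 := hW.transpose.sum_le b A
          rw [← Finset.add_sum_erase A _ ha] at h3
          linarith
      rw [matchingPoly_eq_sub W B x ha]
      rw [← Finset.sum_mul] at hle
      linarith
    refine ⟨?_, fun a ha => ⟨?_, fun hs => ?_⟩⟩
    · rcases A.eq_empty_or_nonempty with rfl | ⟨a, ha⟩
      · rw [matchingPoly_empty]
        positivity
      · obtain ⟨h1, h2⟩ := main a ha
        have := hW.sum_le a B
        have : 0 < (x - (∑ b ∈ B, W a b) * t) * matchingPoly W (A.erase a) B x :=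
          mul_pos (by nlinarith) h1
        linarith
    · obtain ⟨h1, h2⟩ := main a ha
      have := hW.sum_le a B
      refine le_trans (mul_le_mul_of_nonneg_right ?_ h1.le) h2
      nlinarith
    · obtain ⟨h1, h2⟩ := main a ha
      have h3 : 1 / t * matchingPoly W (A.erase a) B x ≤ matchingPoly W A B x :=
        le_trans (mul_le_mul_of_nonneg_right (by nlinarith) h1.le) h2
      calc matchingPoly W (A.erase a) B x = t * (1 / t * matchingPoly W (A.erase a) B x) := by
            field_simp
        _ ≤ _ := mul_le_mul_of_nonneg_left h3 ht.le

lemma degreeLE_permSum [Fintype α] {d : ℕ} (σ : Fin d → Equiv.Perm α) :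
    DegreeLE (permSum σ) (d : ℝ) where
  zero_or_one_le a b := by
    have : permSum σ a b = ((Finset.univ.filter fun k => σ k a = b).card : ℝ) := by
      rw [permSum, Finset.sum_boole]
    rw [this]
    rcases Nat.eq_zero_or_pos (Finset.univ.filter fun k => σ k a = b).card with h | h
    · exact Or.inl (by rw [h, Nat.cast_zero])
    · exact Or.inr (by exact_mod_cast h)
  row a := by
    simp only [permSum]
    rw [Finset.sum_comm]
    simp
  col b := by
    simp only [permSum]
    rw [Finset.sum_comm]
    have : ∀ (k : Fin d) (a : α), (σ k a = b) = (a = (σ k).symm b) := fun k a => by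
      rw [Equiv.eq_symm_apply]
    simp [this]

lemma matchingPoly_univ [Fintype α] (W : α → α → ℝ) (x : ℝ) :
    matchingPoly W Finset.univ Finset.univ x = ∑ j ∈ Finset.range (Fintype.card α + 1),
      (-1) ^ j * matchingSum W j * (x ^ 2) ^ (Fintype.card α - j) := by
  rw [matchingPoly, ← Finset.sum_fiberwise_of_maps_to (t := Finset.range (Fintype.card α + 1))
      (g := Finset.card) (fun M hM => by
        have := (card_le_of_mem_matchings hM).1
        rw [Finset.card_univ] at this
        exact Finset.mem_range.2 (by omega))]
  refine Finset.sum_congr rfl fun j _ => ?_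
  rw [matchingSum, Finset.mul_sum, Finset.sum_mul]
  refine Finset.sum_congr rfl fun M hM => ?_
  rw [(Finset.mem_filter.1 hM).2, ← pow_mul, Finset.card_univ, Nat.mul_sub,
    two_mul (Fintype.card α)]

lemma matchings_erase_univ [Fintype α] (a : α) :
    matchings (Finset.univ.erase a) (Finset.univ : Finset α) =
      {M ∈ matchings (Finset.univ : Finset α) Finset.univ | a ∉ M.image Prod.fst} := by
  ext M
  simp only [Finset.mem_filter, mem_matchings]
  constructor
  · rintro ⟨h1, h2⟩
    refine ⟨⟨by simp, h2⟩, fun h => ?_⟩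
    obtain ⟨e, he, rfl⟩ := Finset.mem_image.1 h
    simpa using (Finset.mem_product.1 (h1 he)).1
  · rintro ⟨⟨-, h2⟩, h3⟩
    refine ⟨fun e he => Finset.mem_product.2 ⟨Finset.mem_erase.2 ⟨?_, Finset.mem_univ _⟩,
      Finset.mem_univ _⟩, h2⟩
    rintro rfl
    exact h3 (Finset.mem_image_of_mem _ he)

/-- A matching of size j misses m-j left vertices (m = `Fintype.card α`), so it is counted m-j
times; in y = x² this is the effect of y·d/dy on y^(m-j). -/
lemma mul_sum_matchingPoly_erase [Fintype α] (W : α → α → ℝ) (x : ℝ) :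
    x * ∑ a, matchingPoly W (Finset.univ.erase a) Finset.univ x =
      ∑ j ∈ Finset.range (Fintype.card α + 1),
        ((Fintype.card α - j : ℕ) : ℝ) * ((-1) ^ j * matchingSum W j *
          (x ^ 2) ^ (Fintype.card α - j)) := by
  have h1 : x * ∑ a, matchingPoly W (Finset.univ.erase a) Finset.univ x =
      ∑ M ∈ matchings (Finset.univ : Finset α) Finset.univ, ((Fintype.card α - M.card : ℕ) : ℝ) *
        ((-1) ^ M.card * (∏ e ∈ M, W e.1 e.2) * (x ^ 2) ^ (Fintype.card α - M.card)) := by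
    simp only [matchingPoly, matchings_erase_univ, Finset.sum_filter]
    rw [Finset.sum_comm, Finset.mul_sum]
    refine Finset.sum_congr rfl fun M hM => ?_
    have hM' := card_le_of_mem_matchings hM
    rw [← Finset.sum_filter, Finset.mul_sum]
    have hc : (Finset.univ.filter fun a => a ∉ M.image Prod.fst).card =
        Fintype.card α - M.card := by
      rw [Finset.filter_notMem_eq_sdiff, Finset.card_sdiff_of_subset (Finset.subset_univ _),
        Finset.card_image_of_injOn (mem_matchings.1 hM).2.1, Finset.card_univ]
    rw [← hc, ← nsmul_eq_mul, ← Finset.sum_const, hc]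
    refine Finset.sum_congr rfl fun a ha => ?_
    have hpos : 0 < Fintype.card α - M.card := hc ▸ Finset.card_pos.2 ⟨a, ha⟩
    rw [Finset.card_erase_of_mem (Finset.mem_univ a), Finset.card_univ, ← pow_mul,
      show 2 * (Fintype.card α - M.card) =
        Fintype.card α - 1 + Fintype.card α - 2 * M.card + 1 by omega, pow_succ]
    ring
  rw [h1, ← Finset.sum_fiberwise_of_maps_to (t := Finset.range (Fintype.card α + 1))
      (g := Finset.card) (fun M hM => by
        have := (card_le_of_mem_matchings hM).1
        rw [Finset.card_univ] at this
        exact Finset.mem_range.2 (by omega))]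
  refine Finset.sum_congr rfl fun j _ => ?_
  rw [matchingSum, Finset.mul_sum, Finset.sum_mul, Finset.mul_sum]
  refine Finset.sum_congr rfl fun M hM => ?_
  rw [(Finset.mem_filter.1 hM).2]

end HeilmannLieb

/-! ### The barrier estimate for n = m -/

/-- `f_d` for `n = m`, evaluated at `x ^ 2`, is an average of matching polynomials. -/
lemma powPoly_eval_sq (m d : ℕ) (x : ℝ) :
    (m ! : ℝ) ^ d * (powPoly m m d 1).eval (x ^ 2) =
      ∑ σ : Fin d → Equiv.Perm (Fin m),
        matchingPoly (permSum σ) Finset.univ Finset.univ x := by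
  simp only [matchingPoly_univ, Fintype.card_fin]
  rw [Finset.sum_comm, powPoly_eval, Finset.mul_sum]
  refine Finset.sum_congr rfl fun j hj => ?_
  have hj : j ≤ m := by have := Finset.mem_range.1 hj; omega
  have := sum_matchingSum_permSum (α := Fin m) d j (by simpa using hj)
  rw [← Finset.sum_mul, ← Finset.mul_sum, this, Fintype.card_fin]
  ring

lemma derivative_powPoly_eval_sq (m d : ℕ) (x : ℝ) :
    (m ! : ℝ) ^ d * (x ^ 2 * (derivative (powPoly m m d 1)).eval (x ^ 2)) =
      x * ∑ σ : Fin d → Equiv.Perm (Fin m), ∑ a,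
        matchingPoly (permSum σ) (Finset.univ.erase a) Finset.univ x := by
  rw [Finset.mul_sum]
  simp only [mul_sum_matchingPoly_erase, Fintype.card_fin]
  have hd : x ^ 2 * (derivative (powPoly m m d 1)).eval (x ^ 2) =
      ∑ l ∈ Finset.range (m + 1), ((m - l : ℕ) : ℝ) * ((-1) ^ l *
      ((m ! : ℝ) * (m ! : ℝ) / (((m - l)! : ℝ) * ((m - l)! : ℝ)) * 1 ^ l *
      PowerSeries.coeff l (genSeries m ^ d)) * (x ^ 2) ^ (m - l)) := by
    rw [powPoly, derivative_sum, eval_finsetSum, Finset.mul_sum]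
    refine Finset.sum_congr rfl fun l _ => ?_
    rw [derivative_C_mul_X_pow, eval_mul, eval_C, eval_pow, eval_X]
    rcases Nat.eq_zero_or_pos (m - l) with h | h
    · simp [h]
    · have : (x ^ 2) ^ (m - l) = x ^ 2 * (x ^ 2) ^ (m - l - 1) := by
        rw [← pow_succ', Nat.sub_add_cancel h]
      rw [this]
      ring
  rw [Finset.sum_comm, hd, Finset.mul_sum]
  refine Finset.sum_congr rfl fun j hj => ?_
  have hj : j ≤ m := by have := Finset.mem_range.1 hj; omega
  have := sum_matchingSum_permSum (α := Fin m) d j (by simpa using hj)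
  rw [← Finset.mul_sum, ← Finset.sum_mul, ← Finset.mul_sum, this, Fintype.card_fin]
  ring

lemma powPoly_self_pos {m d : ℕ} (hd : 1 ≤ d) {t x : ℝ} (ht : 0 < t) (ht1 : t < 1)
    (hx : ((d : ℝ) - 1) * t + 1 / t ≤ x) : 0 < (powPoly m m d 1).eval (x ^ 2) := by
  have hm : (0 : ℝ) < (m ! : ℝ) ^ d := by positivity
  refine (mul_pos_iff_of_pos_left hm).1 ?_
  rw [powPoly_eval_sq]
  exact Finset.sum_pos (fun σ _ => (matchingPoly_estimates (by exact_mod_cast hd) ht ht1 hx _ _ _ _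
    (degreeLE_permSum σ) rfl).1) Finset.univ_nonempty

/-- The vertex-deletion estimate is summed over the m left vertices and all permutation tuples. This
is the initial barrier at x². -/
lemma derivative_powPoly_self_le {m d : ℕ} (hd : 1 ≤ d) {t x : ℝ} (ht : 0 < t) (ht1 : t < 1)
    (hx : ((d : ℝ) - 1) * t + 1 / t ≤ x) :
    (x - d * t) * x * (derivative (powPoly m m d 1)).eval (x ^ 2) ≤
      m * (powPoly m m d 1).eval (x ^ 2) := by
  have hm : (0 : ℝ) < (m ! : ℝ) ^ d := by positivity
  have hd' : (1 : ℝ) ≤ d := by exact_mod_cast hd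
  have hx0 : 0 < x := by
    have : 0 ≤ ((d : ℝ) - 1) * t := mul_nonneg (by linarith) ht.le
    have : 0 < 1 / t := by positivity
    linarith
  have key : (x - d * t) * ∑ σ : Fin d → Equiv.Perm (Fin m), ∑ a,
        matchingPoly (permSum σ) (Finset.univ.erase a) Finset.univ x ≤
      m * ∑ σ : Fin d → Equiv.Perm (Fin m),
        matchingPoly (permSum σ) Finset.univ Finset.univ x := by
    rw [Finset.mul_sum, Finset.mul_sum]
    refine Finset.sum_le_sum fun σ _ => ?_
    rw [Finset.mul_sum]
    have := Finset.sum_le_sum fun a (_ : a ∈ (Finset.univ : Finset (Fin m))) =>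
      ((matchingPoly_estimates hd' ht ht1 hx _ _ _ Finset.univ (degreeLE_permSum σ) rfl).2 a
        (Finset.mem_univ a)).1
    simpa using this
  have e := derivative_powPoly_eval_sq m d x
  rw [← powPoly_eval_sq] at key
  have h1 := mul_le_mul_of_nonneg_left key hx0.le
  have h2 : (m ! : ℝ) ^ d * x * ((x - d * t) * x * (derivative (powPoly m m d 1)).eval (x ^ 2)) ≤
      (m ! : ℝ) ^ d * x * (m * (powPoly m m d 1).eval (x ^ 2)) := by
    calc _ = (x - d * t) * ((m ! : ℝ) ^ d *
          (x ^ 2 * (derivative (powPoly m m d 1)).eval (x ^ 2))) := by ring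
      _ = _ := by rw [e]
      _ ≤ _ := by linarith
  exact le_of_mul_le_mul_left h2 (by positivity)

/-! ### Zeros in half-planes and real-rootedness for n = m -/

/-- The line Re u = c bisects 0 and 2c. After division by u ≠ 0, the half-plane becomes the disc
|2c/u - 1| ≤ 1, whose convexity gives Laguerre's theorem. -/
lemma norm_two_mul_sub_le_iff (c : ℝ) (hc : 0 < c) (u : ℂ) :
    ‖(2 * c : ℂ) - u‖ ≤ ‖u‖ ↔ c ≤ u.re := by
  rw [← sq_le_sq₀ (norm_nonneg _) (norm_nonneg _), ← Complex.normSq_eq_norm_sq,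
    ← Complex.normSq_eq_norm_sq, Complex.normSq_apply, Complex.normSq_apply]
  simp only [Complex.sub_re, Complex.sub_im, Complex.mul_re, Complex.mul_im, Complex.ofReal_re,
    Complex.ofReal_im, Complex.re_ofNat, Complex.im_ofNat]
  constructor <;> intro h <;> nlinarith

/-- Laguerre's theorem for a half-plane. -/
lemma polar_derivative_ne_zero {p : ℂ[X]} {m : ℕ} (hm : 1 ≤ m) (hdeg : p.natDegree ≤ m) {κ : ℝ}
    (hp : ∀ s : ℂ, κ < s.re → p.eval s ≠ 0) {s ζ : ℂ} (hs : κ < s.re) (hζ : κ < ζ.re) :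
    m * p.eval s + (ζ - s) * (derivative p).eval s ≠ 0 := by
  intro h
  have hps := hp s hs
  have hp0 : p ≠ 0 := by rintro rfl; simp at hps
  set c := s.re - κ with hc
  have hc0 : 0 < c := by linarith
  have hsplit := IsAlgClosed.splits p
  rw [hsplit.eval_derivative_eq_eval_mul_sum hps] at h
  set S := (p.roots.map fun z => 1 / (s - z)).sum with hS
  have hsum : (s - ζ) * S = m := by
    have : p.eval s * (m - (s - ζ) * S) = 0 := by linear_combination h
    have := (mul_eq_zero.1 this).resolve_left hps
    linear_combination -this
  have hbound : ∀ t : Multiset ℂ, (∀ z ∈ t, z ∈ p.roots) →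
      ‖2 * c * (t.map fun z => 1 / (s - z)).sum - (Multiset.card t : ℂ)‖ ≤ Multiset.card t := by
    intro t
    induction t using Multiset.induction with
    | empty => simp
    | cons z t ih =>
      intro ht
      have ih := ih fun y hy => ht y (Multiset.mem_cons_of_mem hy)
      have hz : z.re ≤ κ := by
        by_contra! hlt
        exact hp z hlt ((mem_roots hp0).1 (ht z (Multiset.mem_cons_self z t)))
      have hre : c ≤ (s - z).re := by rw [Complex.sub_re]; linarith
      have hne : s - z ≠ 0 := by
        intro h0
        rw [h0, Complex.zero_re] at hre
        linarith
      have h1 : ‖2 * c * (1 / (s - z)) - 1‖ ≤ 1 := by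
        have : (2 * c * (1 / (s - z)) - 1 : ℂ) = ((2 * c : ℂ) - (s - z)) / (s - z) := by
          field_simp
        rw [this, norm_div, div_le_one (norm_pos_iff.2 hne)]
        exact (norm_two_mul_sub_le_iff c hc0 _).2 hre
      rw [Multiset.map_cons, Multiset.sum_cons, Multiset.card_cons]
      push_cast
      calc _ = ‖(2 * c * (1 / (s - z)) - 1) +
            (2 * c * (t.map fun z => 1 / (s - z)).sum - (Multiset.card t : ℂ))‖ := by
              congr 1; ring
        _ ≤ _ := (norm_add_le _ _).trans (by linarith)
  -- When p has fewer than m roots, the missing ones count as roots at infinity: each contributes 0,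
  -- which lies in the same disc around 1.
  have h1 : ‖2 * c * S - m‖ ≤ m := by
    have h2 := hbound p.roots fun _ h => h
    have h3 : Multiset.card p.roots ≤ m := (card_roots' p).trans hdeg
    obtain ⟨k, hk⟩ := Nat.exists_eq_add_of_le h3
    rw [hk]
    push_cast
    calc _ = ‖(2 * c * S - (Multiset.card p.roots : ℂ)) + -(k : ℂ)‖ := by congr 1; ring
      _ ≤ ‖2 * c * S - (Multiset.card p.roots : ℂ)‖ + ‖-(k : ℂ)‖ := norm_add_le _ _
      _ ≤ _ := by rw [norm_neg, Complex.norm_natCast]; linarith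
  have hm0 : (0 : ℝ) < m := by exact_mod_cast hm
  have h4 : ‖(2 * c : ℂ) - (s - ζ)‖ ≤ ‖s - ζ‖ := by
    have e : (m : ℂ) * ((2 * c : ℂ) - (s - ζ)) = (2 * c * S - m) * (s - ζ) := by
      linear_combination (-(2 * c : ℂ)) * hsum
    have e2 := congrArg norm e
    rw [norm_mul, norm_mul, Complex.norm_natCast] at e2
    have := mul_le_mul_of_nonneg_right h1 (norm_nonneg (s - ζ))
    rw [← e2] at this
    exact le_of_mul_le_mul_left this hm0
  have h5 := (norm_two_mul_sub_le_iff c hc0 _).1 h4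
  rw [Complex.sub_re] at h5
  linarith

/-- Laguerre's theorem in terms of coefficients. -/
lemma sum_polar_ne_zero (m : ℕ) (b : ℕ → ℂ) {κ : ℝ}
    (hb : ∀ s : ℂ, κ < s.re → ∑ i ∈ Finset.range (m + 2), b i * s ^ i ≠ 0) {s ζ : ℂ}
    (hs : κ < s.re) (hζ : κ < ζ.re) :
    ∑ i ∈ Finset.range (m + 1),
      (((m + 1 - i : ℕ) : ℂ) * b i + ζ * ((i + 1 : ℕ) * b (i + 1))) * s ^ i ≠ 0 := by
  set p : ℂ[X] := ∑ i ∈ Finset.range (m + 2), C (b i) * X ^ i with hp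
  have heval : ∀ s, p.eval s = ∑ i ∈ Finset.range (m + 2), b i * s ^ i := fun s => by
    simp [hp, eval_finsetSum]
  have hdeg : p.natDegree ≤ m + 1 := natDegree_sum_le_of_forall_le _ _ fun i hi =>
    (natDegree_C_mul_X_pow_le _ _).trans (by have := Finset.mem_range.1 hi; omega)
  have key := polar_derivative_ne_zero (m := m + 1) (by omega) hdeg
    (fun s hs => by rw [heval]; exact hb s hs) hs hζ
  have hder : (derivative p).eval s = ∑ i ∈ Finset.range (m + 1),
      ((i + 1 : ℕ) : ℂ) * b (i + 1) * s ^ i := by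
    rw [hp, derivative_sum, eval_finsetSum, Finset.sum_range_succ']
    simp only [derivative_C_mul_X_pow, eval_mul, eval_C, eval_pow, eval_X, Nat.add_sub_cancel,
      Nat.cast_zero, mul_zero, zero_mul, add_zero]
    exact Finset.sum_congr rfl fun i _ => by ring
  have hder' : s * (derivative p).eval s = ∑ i ∈ Finset.range (m + 2), (i : ℂ) * b i * s ^ i := by
    rw [hder, Finset.sum_range_succ' _ (m + 1), Finset.mul_sum]
    simp only [Nat.cast_zero, zero_mul, add_zero]
    exact Finset.sum_congr rfl fun i _ => by ring
  have hmain : ((m + 1 : ℕ) : ℂ) * p.eval s - s * (derivative p).eval s =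
      ∑ i ∈ Finset.range (m + 1), ((m + 1 - i : ℕ) : ℂ) * b i * s ^ i := by
    rw [hder', heval, Finset.mul_sum, ← Finset.sum_sub_distrib, Finset.sum_range_succ, mul_assoc,
      sub_self, add_zero]
    refine Finset.sum_congr rfl fun i hi => ?_
    rw [Nat.cast_sub (by have := Finset.mem_range.1 hi; omega)]
    ring
  have e : ((m + 1 : ℕ) : ℂ) * p.eval s + (ζ - s) * (derivative p).eval s =
      (((m + 1 : ℕ) : ℂ) * p.eval s - s * (derivative p).eval s) +
        ζ * (derivative p).eval s := by ring
  rw [e, hmain, hder, Finset.mul_sum, ← Finset.sum_add_distrib] at key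
  intro h
  refine key (Eq.trans (Finset.sum_congr rfl fun i _ => ?_) h)
  ring

/-- If d = -a, the form vanishes along r = (1 + c't)/(t - b'), where b' = b/a and c' = c/a. As t →
+∞ this r tends to c', whose real part is nonnegative, so r and t both enter the half-plane. The
slack κ < 0 makes the limit usable. -/
lemma add_ne_zero_of_bilinear_ne_zero {a b c d : ℂ} {κ : ℝ} (hκ : κ < 0)
    (h : ∀ r t : ℂ, κ < r.re → κ < t.re → a + b * r + c * t + d * (r * t) ≠ 0) : a + d ≠ 0 := by
  intro had
  have hd : d = -a := by linear_combination had
  have ha : a ≠ 0 := by simpa using h 0 0 (by simpa) (by simpa)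
  set c' := c / a with hc'
  set b' := b / a with hb'
  have hc : c = c' * a := by rw [hc']; field_simp
  have hb : b = b' * a := by rw [hb']; field_simp
  have hre : 0 ≤ c'.re := by
    by_contra! hlt
    have hne : c' ≠ 0 := by rintro h0; rw [h0, Complex.zero_re] at hlt; linarith
    -- At r = 0 the form is a(1 + c't), so a negative real part of c' would put its zero in the
    -- right half-plane.
    refine h 0 (-1 / c') (by simpa) ?_ ?_
    · have : (-1 / c').re = -c'.re / Complex.normSq c' := by
        rw [Complex.div_re]; simp
      rw [this]
      exact hκ.trans (div_pos (by linarith) (Complex.normSq_pos.2 hne))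
    · rw [hc]
      field_simp
      ring
  have hlim : Filter.Tendsto (fun τ : ℝ => ((c' + τ) / (1 - τ * b')).re) (nhds 0)
      (nhds c'.re) := by
    have : ContinuousAt (fun τ : ℝ => ((c' + τ) / (1 - τ * b')).re) 0 := by
      refine Complex.continuous_re.continuousAt.comp (ContinuousAt.div ?_ ?_ ?_)
      · fun_prop
      · fun_prop
      · simp
    simpa [ContinuousAt] using this
  have hlim2 : Filter.Tendsto (fun τ : ℝ => (1 - τ * b' : ℂ)) (nhds 0) (nhds 1) := by
    have : ContinuousAt (fun τ : ℝ => (1 - τ * b' : ℂ)) 0 := by fun_prop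
    simpa [ContinuousAt] using this
  have hev := ((hlim.eventually (lt_mem_nhds (hκ.trans_le hre))).and
    (hlim2.eventually_ne one_ne_zero))
  have hev' := (hev.filter_mono (nhdsWithin_le_nhds (s := Set.Ioi 0))).and self_mem_nhdsWithin
  obtain ⟨τ, ⟨h1, h2⟩, h3⟩ := hev'.exists
  have h3 : 0 < τ := h3
  refine h _ (1 / τ) h1 ?_ ?_
  · have : (1 / (τ : ℂ)).re = 1 / τ := by
      rw [← Complex.ofReal_one, ← Complex.ofReal_div, Complex.ofReal_re]
    rw [this]
    exact hκ.trans (by positivity)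
  · have h4 : (τ : ℂ) ≠ 0 := by exact_mod_cast h3.ne'
    have h5 : (c' + τ) / (1 - τ * b') * (1 - τ * b') = c' + τ := div_mul_cancel₀ _ h2
    rw [hd, hc, hb]
    generalize (c' + τ) / (1 - τ * b') = R at h5
    have h6 : b' * a * R + c' * a * (1 / τ) + -a * (R * (1 / τ)) + a =
        a / τ * (c' + τ - R * (1 - τ * b')) := by
      field_simp
      ring
    linear_combination h6 - a / τ * h5

/-- A two-variable form of Grace's theorem: the diagonal contraction of a polynomial without zeros
in a product of half-planes does not vanish. -/
theorem diagonal_contraction_ne_zero (m : ℕ) (c : ℕ → ℕ → ℂ) {κ : ℝ} (hκ : κ < 0)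
    (hc : ∀ r t : ℂ, κ < r.re → κ < t.re →
      ∑ i ∈ Finset.range (m + 1), ∑ j ∈ Finset.range (m + 1), c i j * r ^ i * t ^ j ≠ 0) :
    ∑ i ∈ Finset.range (m + 1), c i i / (m.choose i : ℂ) ≠ 0 := by
  induction m generalizing c with
  | zero => simpa using hc 0 0 (by simpa) (by simpa)
  | succ m ih =>
    -- Polarising both variables gives a bilinear form in new variables r₁, t₁. Adding its constant
    -- and r₁t₁ coefficients lowers the degree by one while keeping the polynomial zero-free.
    set c' : ℕ → ℕ → ℂ := fun i j => ((m + 1 - i : ℕ) : ℂ) * ((m + 1 - j : ℕ) : ℂ) * c i j +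
      ((i + 1 : ℕ) : ℂ) * ((j + 1 : ℕ) : ℂ) * c (i + 1) (j + 1) with hc'
    have hpolar : ∀ r t r₁ t₁ : ℂ, κ < r.re → κ < t.re → κ < r₁.re → κ < t₁.re →
        ∑ j ∈ Finset.range (m + 1), (((m + 1 - j : ℕ) : ℂ) * (∑ i ∈ Finset.range (m + 1),
          (((m + 1 - i : ℕ) : ℂ) * c i j + r₁ * ((i + 1 : ℕ) * c (i + 1) j)) * r ^ i) +
          t₁ * ((j + 1 : ℕ) * (∑ i ∈ Finset.range (m + 1),
          (((m + 1 - i : ℕ) : ℂ) * c i (j + 1) +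
            r₁ * ((i + 1 : ℕ) * c (i + 1) (j + 1))) * r ^ i))) * t ^ j ≠ 0 := by
      intro r t r₁ t₁ hr ht hr₁ ht₁
      refine sum_polar_ne_zero m (fun j => ∑ i ∈ Finset.range (m + 1),
          (((m + 1 - i : ℕ) : ℂ) * c i j + r₁ * ((i + 1 : ℕ) * c (i + 1) j)) * r ^ i)
          (fun s hs => ?_) ht ht₁
      have h1 := sum_polar_ne_zero m (fun i => ∑ j ∈ Finset.range (m + 2), c i j * s ^ j)
        (fun s' hs' => ?_) hr hr₁
      · intro h0
        refine h1 (Eq.trans ?_ h0)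
        simp only [Finset.sum_mul]
        rw [Finset.sum_comm]
        refine Finset.sum_congr rfl fun i _ => ?_
        simp only [Finset.mul_sum]
        rw [← Finset.sum_add_distrib, Finset.sum_mul]
        exact Finset.sum_congr rfl fun j _ => by ring
      · intro h0
        refine hc s' s hs' hs (Eq.trans ?_ h0)
        refine Finset.sum_congr rfl fun i _ => ?_
        rw [Finset.sum_mul]
        exact Finset.sum_congr rfl fun j _ => by ring
    have hstep := ih c' fun r t hr ht => by
      have hbil := add_ne_zero_of_bilinear_ne_zero hκ
        (a := ∑ j ∈ Finset.range (m + 1), ∑ i ∈ Finset.range (m + 1),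
          ((m + 1 - i : ℕ) : ℂ) * ((m + 1 - j : ℕ) : ℂ) * c i j * r ^ i * t ^ j)
        (b := ∑ j ∈ Finset.range (m + 1), ∑ i ∈ Finset.range (m + 1),
          ((i + 1 : ℕ) : ℂ) * ((m + 1 - j : ℕ) : ℂ) * c (i + 1) j * r ^ i * t ^ j)
        (c := ∑ j ∈ Finset.range (m + 1), ∑ i ∈ Finset.range (m + 1),
          ((m + 1 - i : ℕ) : ℂ) * ((j + 1 : ℕ) : ℂ) * c i (j + 1) * r ^ i * t ^ j)
        (d := ∑ j ∈ Finset.range (m + 1), ∑ i ∈ Finset.range (m + 1),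
          ((i + 1 : ℕ) : ℂ) * ((j + 1 : ℕ) : ℂ) * c (i + 1) (j + 1) * r ^ i * t ^ j)
        (fun r₁ t₁ hr₁ ht₁ h0 => hpolar r t r₁ t₁ hr ht hr₁ ht₁ (Eq.trans ?_ h0))
      · intro h0
        rw [Finset.sum_comm] at h0
        refine hbil (Eq.trans ?_ h0)
        rw [← Finset.sum_add_distrib]
        refine Finset.sum_congr rfl fun j _ => ?_
        rw [← Finset.sum_add_distrib]
        exact Finset.sum_congr rfl fun i _ => by simp only [hc']; ring
      · simp only [Finset.sum_mul, ← Finset.sum_add_distrib]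
        refine Finset.sum_congr rfl fun j _ => ?_
        simp only [Finset.mul_sum, Finset.sum_mul, ← Finset.sum_add_distrib]
        exact Finset.sum_congr rfl fun i _ => by ring
    -- The reduction preserves the diagonal contraction up to the factor (m+1)².
    have hid : ∑ i ∈ Finset.range (m + 1), c' i i / (m.choose i : ℂ) = ((m + 1 : ℕ) : ℂ) ^ 2 *
        ∑ i ∈ Finset.range (m + 2), c i i / ((m + 1).choose i : ℂ) := by
      have hsplit : ((m + 1 : ℕ) : ℂ) ^ 2 *
          ∑ i ∈ Finset.range (m + 2), c i i / ((m + 1).choose i : ℂ) =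
          ∑ i ∈ Finset.range (m + 2), ((m + 1 : ℕ) : ℂ) * ((m + 1 - i : ℕ) : ℂ) *
            (c i i / ((m + 1).choose i : ℂ)) +
          ∑ i ∈ Finset.range (m + 2), ((m + 1 : ℕ) : ℂ) * (i : ℂ) *
            (c i i / ((m + 1).choose i : ℂ)) := by
        rw [← Finset.sum_add_distrib, Finset.mul_sum]
        refine Finset.sum_congr rfl fun i hi => ?_
        rw [Nat.cast_sub (by have := Finset.mem_range.1 hi; omega)]
        ring
      rw [hsplit, Finset.sum_range_succ _ (m + 1), Finset.sum_range_succ' _ (m + 1), Nat.sub_self]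
      simp only [Nat.cast_zero, mul_zero, zero_mul, add_zero]
      rw [← Finset.sum_add_distrib]
      refine Finset.sum_congr rfl fun i hi => ?_
      have hi : i ≤ m := by have := Finset.mem_range.1 hi; omega
      have e1 : (m.choose i : ℂ) * ((m + 1 : ℕ) : ℂ) =
          ((m + 1).choose i : ℂ) * ((m + 1 - i : ℕ) : ℂ) := by
        exact_mod_cast Nat.choose_mul_succ_eq m i
      have e2 : ((m + 1 : ℕ) : ℂ) * (m.choose i : ℂ) =
          ((m + 1).choose (i + 1) : ℂ) * ((i + 1 : ℕ) : ℂ) := by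
        exact_mod_cast Nat.add_one_mul_choose_eq m i
      have n1 : (m.choose i : ℂ) ≠ 0 := by exact_mod_cast (Nat.choose_pos hi).ne'
      have n2 : ((m + 1).choose i : ℂ) ≠ 0 := by
        exact_mod_cast (Nat.choose_pos (by omega : i ≤ m + 1)).ne'
      have n3 : ((m + 1).choose (i + 1) : ℂ) ≠ 0 := by
        exact_mod_cast (Nat.choose_pos (by omega : i + 1 ≤ m + 1)).ne'
      simp only [hc']
      rw [add_div]
      congr 1
      · field_simp
        linear_combination (-((m + 1 - i : ℕ) : ℂ) * c i i) * e1
      · field_simp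
        linear_combination (-c (i + 1) (i + 1)) * e2
    rw [hid] at hstep
    exact right_ne_zero_of_mul hstep

/-- One convolution step for `n = m`, evaluated at a complex point. -/
lemma aeval_powPoly_succ (m d : ℕ) (x : ℂ) :
    aeval x (powPoly m m (d + 1) 1) = ∑ j ∈ Finset.range (m + 1),
      ∑ i ∈ Finset.range (m + 1), (((powPoly m m d 1).coeff (m - j) : ℝ) : ℂ) *
        ((-1) ^ i * ((m - j).choose i : ℂ) ^ 2 / (m.choose i : ℂ) * x ^ (m - j - i)) := by
  set A : ℕ → ℕ → ℝ := fun d l => (m ! : ℝ) * (m ! : ℝ) / (((m - l)! : ℝ) * ((m - l)! : ℝ)) *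
    1 ^ l * PowerSeries.coeff l (genSeries m ^ d) with hA
  have hcoeff : ∀ j ≤ m, (powPoly m m d 1).coeff (m - j) = (-1) ^ j * A d j := fun j hj =>
    coeff_sum_C_mul_X_pow_sub m j hj (fun j => (-1) ^ j * A d j)
  have hfac := Nat.factorial_ne_zero
  have hAsucc : ∀ l ≤ m, A (d + 1) l = ∑ j ∈ Finset.range (l + 1),
      A d j * (((m - j).choose (l - j) : ℝ) ^ 2 / (m.choose (l - j) : ℝ)) := by
    intro l hl
    simp only [hA]
    rw [pow_succ, PowerSeries.coeff_mul, Finset.Nat.sum_antidiagonal_eq_sum_range_succ (fun j i =>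
      PowerSeries.coeff j (genSeries m ^ d) * PowerSeries.coeff i (genSeries m)), Finset.mul_sum]
    refine Finset.sum_congr rfl fun j hj => ?_
    have hj : j ≤ l := by have := Finset.mem_range.1 hj; omega
    rw [genSeries, PowerSeries.coeff_mk, Nat.cast_choose ℝ (show l - j ≤ m - j by omega),
      Nat.cast_choose ℝ (show l - j ≤ m by omega), show m - j - (l - j) = m - l by omega,
      one_pow, one_pow]
    field_simp
  have h1 : aeval x (powPoly m m (d + 1) 1) = ∑ l ∈ Finset.range (m + 1),
      ∑ j ∈ Finset.range (l + 1), ((-1) ^ j * A d j : ℂ) *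
        ((-1) ^ (l - j) * ((m - j).choose (l - j) : ℂ) ^ 2 / (m.choose (l - j) : ℂ) *
          x ^ (m - j - (l - j))) := by
    rw [powPoly, map_sum]
    refine Finset.sum_congr rfl fun l hl => ?_
    have hl : l ≤ m := by have := Finset.mem_range.1 hl; omega
    have e : aeval x (C ((-1) ^ l * A (d + 1) l) * X ^ (m - l)) =
        ((-1) ^ l * (A (d + 1) l : ℂ)) * x ^ (m - l) := by
      rw [map_mul, aeval_C, map_pow, aeval_X, Complex.coe_algebraMap]
      push_cast
      rfl
    refine e.trans ?_
    rw [hAsucc l hl]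
    push_cast
    rw [Finset.mul_sum, Finset.sum_mul]
    refine Finset.sum_congr rfl fun j hj => ?_
    have hj : j ≤ l := by have := Finset.mem_range.1 hj; omega
    rw [show m - j - (l - j) = m - l by omega]
    have : (-1 : ℂ) ^ l = (-1) ^ j * (-1) ^ (l - j) := by rw [← pow_add, Nat.add_sub_of_le hj]
    rw [this]
    ring
  -- The triangular sum is reindexed by j and i = l-j; i may then run up to m, since the binomial
  -- vanishes for i > m-j.
  rw [h1, Finset.sum_range_diag_flip (m + 1) (fun j i => ((-1) ^ j * A d j : ℂ) *
        ((-1) ^ i * ((m - j).choose i : ℂ) ^ 2 / (m.choose i : ℂ) * x ^ (m - j - i)))]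
  refine Finset.sum_congr rfl fun j hj => ?_
  have hj : j ≤ m := by have := Finset.mem_range.1 hj; omega
  rw [hcoeff j hj]
  push_cast
  refine Finset.sum_subset (fun i hi => ?_) fun i _ hi => ?_
  · have := Finset.mem_range.1 hi
    exact Finset.mem_range.2 (by omega)
  · have : m - j < i := by
      have := mt Finset.mem_range.2 hi
      omega
    simp [Nat.choose_eq_zero_of_lt this]

lemma aeval_eq_sum_coeff_sub {p : ℝ[X]} {m : ℕ} (hp : p.natDegree ≤ m) (x : ℂ) :
    aeval x p = ∑ j ∈ Finset.range (m + 1), ((p.coeff (m - j) : ℝ) : ℂ) * x ^ (m - j) := by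
  rw [aeval_eq_sum_range' (Nat.lt_succ_of_le hp), ← Finset.sum_range_reflect]
  refine Finset.sum_congr rfl fun j hj => ?_
  rw [show m + 1 - 1 - j = m - j by omega, Complex.real_smul]

/-- All complex roots of the convolution powers of `(x - 1) ^ m` for `n = m` are real and
nonnegative. -/
theorem powPoly_self_complex_roots (m d : ℕ) (x : ℂ) (hx : aeval x (powPoly m m d 1) = 0) :
    x.im = 0 ∧ 0 ≤ x.re := by
  induction d generalizing x with
  | zero =>
    have h1 : aeval x (powPoly m m 0 1) = x ^ m := by
      rw [powPoly, map_sum, Finset.sum_eq_single 0]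
      · simp [Nat.factorial_ne_zero]
      · intro l _ hl
        simp [PowerSeries.coeff_one, hl]
      · simp
    rw [h1] at hx
    simp [eq_zero_of_pow_eq_zero hx]
  | succ d ih =>
    by_contra hnot
    have hslit : -x ∈ Complex.slitPlane := by
      rw [Complex.mem_slitPlane_iff, Complex.neg_re, Complex.neg_im]
      by_contra! h
      exact hnot ⟨by linarith [neg_eq_zero.1 h.2], by linarith⟩
    -- Off [0, ∞) the number -x has a square root in the open right half-plane.
    obtain ⟨z, hz, hzre⟩ : ∃ z : ℂ, z ^ 2 = -x ∧ 0 < z.re := by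
      refine ⟨(-x) ^ (2⁻¹ : ℂ), Complex.cpow_ofNat_inv_pow (-x) 2, ?_⟩
      rw [Complex.cpow_inv_two_re]
      refine Real.sqrt_pos.2 (half_pos ?_)
      rcases hslit with h | h
      · have := norm_nonneg (-x)
        linarith
      · have := (abs_lt.1 (Complex.abs_re_lt_norm.2 h)).1
        linarith
    set q := powPoly m m d 1 with hq
    -- These are the coefficients of q(-(z+r)(z+t)) in r and t. Their diagonal contraction is the
    -- next convolution power at -z² = x.
    set c : ℕ → ℕ → ℂ := fun i i' => ∑ j ∈ Finset.range (m + 1), ((q.coeff (m - j) : ℝ) : ℂ) *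
      (-1) ^ (m - j) * (((m - j).choose i : ℂ) * z ^ (m - j - i)) *
        (((m - j).choose i' : ℂ) * z ^ (m - j - i')) with hc
    have hbinom : ∀ k ≤ m, ∀ r : ℂ, ∑ i ∈ Finset.range (m + 1),
        (k.choose i : ℂ) * z ^ (k - i) * r ^ i = (z + r) ^ k := by
      intro k hk r
      rw [add_comm z r, add_pow]
      refine (Finset.sum_subset (fun i hi => ?_) fun i _ hi => ?_).symm.trans
        (Finset.sum_congr rfl fun i _ => by ring)
      · have := Finset.mem_range.1 hi
        exact Finset.mem_range.2 (by omega)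
      · have : k < i := by
          have := mt Finset.mem_range.2 hi
          omega
        simp [Nat.choose_eq_zero_of_lt this]
    refine diagonal_contraction_ne_zero m c (κ := -z.re) (by linarith) (fun r t hr ht h0 => ?_) ?_
    · have hval : ∑ i ∈ Finset.range (m + 1), ∑ i' ∈ Finset.range (m + 1), c i i' * r ^ i * t ^ i' =
          aeval (-((z + r) * (z + t))) q := by
        rw [aeval_eq_sum_coeff_sub (powPoly_natDegree_le m m d 1)]
        simp only [hc, Finset.sum_mul]
        rw [Finset.sum_congr rfl fun i _ => Finset.sum_comm, Finset.sum_comm]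
        refine Finset.sum_congr rfl fun j _ => ?_
        rw [neg_pow ((z + r) * (z + t)), mul_pow, ← hbinom (m - j) (Nat.sub_le m j) r,
          ← hbinom (m - j) (Nat.sub_le m j) t, Finset.sum_mul_sum, Finset.mul_sum, Finset.mul_sum]
        refine Finset.sum_congr rfl fun i _ => ?_
        rw [Finset.mul_sum, Finset.mul_sum]
        exact Finset.sum_congr rfl fun i' _ => by ring
      rw [hval] at h0
      obtain ⟨h1, h2⟩ := ih _ h0
      have hu : 0 < (z + r).re := by rw [Complex.add_re]; linarith
      have hv : 0 < (z + t).re := by rw [Complex.add_re]; linarith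
      generalize z + r = u at *
      generalize z + t = v at *
      simp only [Complex.neg_im, Complex.neg_re, Complex.mul_re, Complex.mul_im] at h1 h2
      -- By induction -uv would be real and nonnegative, but the product of two numbers with
      -- positive real part is never in (-∞, 0].
      have h3 : u.im * v.re = -(u.re * v.im) := by linarith
      have h4 : u.re * v.re ≤ u.im * v.im := by linarith
      have h5 : u.im * v.im * v.re ≤ 0 := by
        have : u.im * v.im * v.re = -(u.re * v.im ^ 2) := by
          linear_combination v.im * h3
        rw [this]
        have : 0 ≤ u.re * v.im ^ 2 := by positivity
        linarith
      nlinarith [mul_pos (mul_pos hu hv) hv, mul_le_mul_of_nonneg_right h4 hv.le]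
    · rw [aeval_powPoly_succ, Finset.sum_comm] at hx
      refine Eq.trans (Finset.sum_congr rfl fun i _ => ?_) hx
      simp only [hc]
      rw [Finset.sum_div]
      refine Finset.sum_congr rfl fun j _ => ?_
      rcases le_or_gt i (m - j) with hi | hi
      · have e1 : x = -z ^ 2 := by rw [hz, neg_neg]
        have e2 : (-1 : ℂ) ^ (m - j) = (-1) ^ i * (-1) ^ (m - j - i) := by
          rw [← pow_add, Nat.add_sub_of_le hi]
        rw [e1, neg_pow (z ^ 2), e2]
        ring
      · simp [Nat.choose_eq_zero_of_lt hi]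

theorem powPoly_self_splits (m d : ℕ) : (powPoly m m d 1).Splits := by
  refine Splits.of_splits_map (algebraMap ℝ ℂ) (IsAlgClosed.splits _) fun a ha => ?_
  have h0 := (mem_roots'.1 ha).2
  rw [IsRoot, eval_map_algebraMap] at h0
  exact ⟨a.re, Complex.ext (by simp) (by simp [(powPoly_self_complex_roots m d a h0).1])⟩

/-! ### From n = m to general n, and the choice of t -/

lemma powPoly_splits (m n d : ℕ) (hm : n ≤ m) : (powPoly m n d 1).Splits := by
  induction hk : m - n generalizing n with
  | zero =>
    obtain rfl : n = m := by omega
    exact powPoly_self_splits n d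
  | succ k ih =>
    have h1 := splits_derivative (ih (n + 1) (by omega) (by omega))
    rw [powPoly_derivative] at h1
    have hn : ((n + 1 : ℕ) : ℝ) ≠ 0 := by positivity
    have h2 := (Splits.C ((n + 1 : ℕ) : ℝ)⁻¹).mul h1
    rwa [← mul_assoc, ← C_mul, inv_mul_cancel₀ hn, C_1, one_mul] at h2

/-- The barrier, moved through `m - n` derivatives. -/
lemma powPoly_barrier {m d : ℕ} {b δ : ℝ} (hδ : 0 ≤ δ)
    (hb : ∀ a, (powPoly m m d 1).eval a = 0 → a < b)
    (h : δ * (derivative (powPoly m m d 1)).eval b ≤ (powPoly m m d 1).eval b)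
    (k n : ℕ) (hn : 1 ≤ n) (hk : n + k = m) :
    (∀ a, (powPoly m n d 1).eval a = 0 → a < b - k * δ) ∧
      δ * (derivative (powPoly m n d 1)).eval (b - k * δ) ≤
        (powPoly m n d 1).eval (b - k * δ) := by
  induction k generalizing n with
  | zero =>
    obtain rfl : n = m := by omega
    simpa using And.intro hb h
  | succ k ih =>
    obtain ⟨h1, h2⟩ := ih (n + 1) (by omega) (by omega)
    have h3 := barrier_derivative (powPoly_splits m (n + 1) d (by omega))
      (powPoly_monic m (n + 1) d 1) (by rw [powPoly_natDegree]; omega) hδ h1 h2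
    have hn0 : (0 : ℝ) < ((n + 1 : ℕ) : ℝ) := by positivity
    have e : b - ((k + 1 : ℕ) : ℝ) * δ = b - k * δ - δ := by push_cast; ring
    rw [powPoly_derivative, derivative_C_mul] at h3
    simp only [eval_mul, eval_C] at h3
    rw [e]
    refine ⟨fun a ha => h3.1 a (by rw [ha, mul_zero]), ?_⟩
    refine le_of_mul_le_mul_left ?_ hn0
    linarith [h3.2]

/-- With x = (d-1)t + 1/t, the right side is x² - (m-n)δ for δ = (x-dt)x/m: the initial barrier
moved by m-n derivatives. -/
lemma powPoly_root_le {m n d : ℕ} (hn : 1 ≤ n) (hm : n ≤ m) (hd : 2 ≤ d) {y t : ℝ}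
    (hy : (powPoly m n d 1).eval y = 0) (ht : 0 < t) (ht1 : t < 1) :
    y ≤ ((d : ℝ) - 1) * (d - n / m) * t ^ 2 + (d - n / m) + (d - 1) * (n / m) +
      n / m / t ^ 2 := by
  have hd' : (2 : ℝ) ≤ d := by exact_mod_cast hd
  have hm0 : (0 : ℝ) < m := by exact_mod_cast (by omega : 0 < m)
  set x : ℝ := ((d : ℝ) - 1) * t + 1 / t with hx
  have ht' : 1 < 1 / t := by rw [lt_div_iff₀ ht]; linarith
  have hx0 : 0 < x := by
    have : 0 ≤ ((d : ℝ) - 1) * t := mul_nonneg (by linarith) ht.le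
    linarith
  have hxd : 0 < x - d * t := by
    have : x - d * t = 1 / t - t := by rw [hx]; ring
    linarith
  have hroot : ∀ a, (powPoly m m d 1).eval a = 0 → a < x ^ 2 := by
    intro a ha
    by_contra! hle
    have h1 : x ≤ √a := Real.le_sqrt_of_sq_le hle
    have h2 := powPoly_self_pos (m := m) (by omega : 1 ≤ d) ht ht1 h1
    rw [Real.sq_sqrt ((sq_nonneg x).trans hle), ha] at h2
    exact lt_irrefl _ h2
  have hδ : (x - d * t) * x / m * (derivative (powPoly m m d 1)).eval (x ^ 2) ≤
      (powPoly m m d 1).eval (x ^ 2) := by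
    have := derivative_powPoly_self_le (m := m) (by omega : 1 ≤ d) ht ht1 hx.ge
    rw [div_mul_eq_mul_div, div_le_iff₀ hm0]
    linarith
  obtain ⟨k, rfl⟩ := Nat.exists_eq_add_of_le hm
  have hb := (powPoly_barrier (by positivity) hroot hδ k n hn rfl).1 y hy
  refine hb.le.trans (le_of_eq ?_)
  rw [hx]
  push_cast at hm0 ⊢
  field_simp
  ring

lemma powPoly_root_le_sq {m n d : ℕ} (hn : 1 ≤ n) (hm : n ≤ m) (hd : 2 ≤ d) {y : ℝ}
    (hy : (powPoly m n d 1).eval y = 0) :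
    y ≤ (√((n : ℝ) / m * (d - 1)) + √((d : ℝ) - n / m)) ^ 2 := by
  have hd' : (2 : ℝ) ≤ d := by exact_mod_cast hd
  have hm0 : (0 : ℝ) < m := by exact_mod_cast (by omega : 0 < m)
  have hn0 : (0 : ℝ) < n := by exact_mod_cast (by omega : 0 < n)
  have hbound := fun t => powPoly_root_le (t := t) hn hm hd hy
  have hρ1 : (n : ℝ) / m ≤ 1 := by rw [div_le_one hm0]; exact_mod_cast hm
  have hρ0 : 0 < (n : ℝ) / m := by positivity
  generalize (n : ℝ) / m = ρ at *
  generalize (d : ℝ) = D at *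
  set u := √(ρ * (D - 1)) with hu
  set v := √(D - ρ) with hv
  have hD1 : 0 < D - 1 := by linarith
  have hDρ : 0 < D - ρ := by linarith
  have hu0 : 0 < u := Real.sqrt_pos.2 (by positivity)
  have hv0 : 0 < v := Real.sqrt_pos.2 hDρ
  have hu2 : u ^ 2 = ρ * (D - 1) := Real.sq_sqrt (by positivity)
  have hv2 : v ^ 2 = D - ρ := Real.sq_sqrt hDρ.le
  -- This t balances the two t-dependent terms: each becomes uv, so the bound is (u+v)².
  set t := √(u / ((D - 1) * v)) with ht
  have ht0 : 0 < t := Real.sqrt_pos.2 (by positivity)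
  have ht2 : t ^ 2 = u / ((D - 1) * v) := Real.sq_sqrt (by positivity)
  have ht1 : t ≤ 1 := by
    refine Real.sqrt_le_iff.2 ⟨zero_le_one, ?_⟩
    rw [one_pow, div_le_one (by positivity)]
    refine abs_le_of_sq_le_sq' ?_ (by positivity) |>.2
    rw [mul_pow, hu2, hv2]
    nlinarith [mul_pos hD1 hDρ]
  -- The optimal t can equal 1 (when d = 2 and n = m), while the bound needs t < 1; hence the limit
  -- from the left.
  have hcont : Filter.Tendsto (fun t : ℝ => (D - 1) * (D - ρ) * t ^ 2 + (D - ρ) + (D - 1) * ρ +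
      ρ / t ^ 2) (nhdsWithin t (Set.Iio t)) (nhds ((D - 1) * (D - ρ) * t ^ 2 + (D - ρ) +
      (D - 1) * ρ + ρ / t ^ 2)) := by
    refine Filter.Tendsto.mono_left ?_ nhdsWithin_le_nhds
    have : ContinuousAt (fun t : ℝ => (D - 1) * (D - ρ) * t ^ 2 + (D - ρ) + (D - 1) * ρ +
      ρ / t ^ 2) t := by
      refine ContinuousAt.add (by fun_prop) (ContinuousAt.div (by fun_prop) (by fun_prop) ?_)
      positivity
    exact this
  have hle := ge_of_tendsto hcont (by
    filter_upwards [Ioo_mem_nhdsLT ht0] with s hs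
    exact hbound s hs.1 (hs.2.trans_le ht1))
  refine hle.trans (le_of_eq ?_)
  have e1 : (D - 1) * (D - ρ) * t ^ 2 = u * v := by
    rw [ht2, ← hv2]
    field_simp
  have e2 : ρ / t ^ 2 = u * v := by
    rw [ht2]
    field_simp
    linarith
  rw [e1, e2, add_sq, hu2, hv2]
  ring

lemma powPoly_eq_comp (m n d : ℕ) {θ : ℝ} (hθ : θ ≠ 0) :
    powPoly m n d θ = C (θ ^ n) * (powPoly m n d 1).comp (C θ⁻¹ * X) := by
  refine funext fun x => ?_
  rw [eval_mul, eval_comp, eval_C, eval_mul, eval_C, eval_X, ← powPoly_eval_mul,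
    mul_inv_cancel_left₀ hθ]

lemma substSq_splits {p : ℝ[X]} (hp : p.Splits) (hroots : ∀ a ∈ p.roots, 0 ≤ a) :
    (substSq p).Splits := by
  rw [substSq, hp.eq_prod_roots, mul_comp, C_comp, multiset_prod_comp]
  refine (Splits.C _).mul (Splits.multisetProd fun q hq => ?_)
  rw [Multiset.map_map] at hq
  obtain ⟨a, ha, rfl⟩ := Multiset.mem_map.1 hq
  have : (X - C a : ℝ[X]).comp (X ^ 2) = (X - C (√a)) * (X - C (-√a)) := by
    rw [sub_comp, X_comp, C_comp, C_neg]
    have : (C a : ℝ[X]) = C (√a) ^ 2 := by rw [← C_pow, Real.sq_sqrt (hroots a ha)]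
    rw [this]
    ring
  simp only [Function.comp, this]
  exact (Splits.X_sub_C _).mul (Splits.X_sub_C _)

end

/-! ### Dilation by θ and the bound on the largest root -/

theorem corollary3p2 (θ : ℝ) (hθ : 2 ≤ θ) (d n m : ℕ) (hd : 2 ≤ d) (hn : 1 ≤ n) (hm : n ≤ m) :
    (qPoly θ m n d).Splits ∧
    ∃ r : ℝ, IsGreatest {x : ℝ | (qPoly θ m n d).IsRoot x} r ∧
      r ≤ √(θ * (n : ℝ) / (m : ℝ)) *
        (√((d : ℝ) - 1) + √((d : ℝ) * (m : ℝ) / (n : ℝ) - 1)) := by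
  have hθ0 : 0 < θ := by linarith
  have hm0 : (0 : ℝ) < m := by exact_mod_cast (by omega : 0 < m)
  have hn0 : (0 : ℝ) < n := by exact_mod_cast (by omega : 0 < n)
  have hq : qPoly θ m n d = substSq (powPoly m n d θ) := by
    obtain ⟨k, rfl⟩ : ∃ k, d = k + 1 := ⟨d - 1, by omega⟩
    rw [qPoly, rectConvPow_eq_powPoly]
  have hsplits : (qPoly θ m n d).Splits := by
    rw [hq]
    refine substSq_splits ?_ fun a ha => powPoly_root_nonneg m n d θ a hθ0.le (mem_roots'.1 ha).2
    rw [powPoly_eq_comp m n d hθ0.ne']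
    exact (Splits.C _).mul ((powPoly_splits m n d hm).comp_of_natDegree_le_one
      ((natDegree_C_mul_le _ _).trans natDegree_X_le))
  have hdeg : (qPoly θ m n d).natDegree = n * 2 := by
    rw [hq, substSq, natDegree_comp, powPoly_natDegree, natDegree_X_pow]
  have hne : qPoly θ m n d ≠ 0 := by
    intro h0
    rw [h0, natDegree_zero] at hdeg
    omega
  have hfin : {x : ℝ | (qPoly θ m n d).IsRoot x}.Finite := finite_setOfPred_isRoot hne
  have hnonempty : {x : ℝ | (qPoly θ m n d).IsRoot x}.Nonempty :=
    hsplits.exists_eval_eq_zero (by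
      rw [degree_eq_natDegree hne, hdeg]
      exact_mod_cast (by omega : n * 2 ≠ 0))
  obtain ⟨r, hr⟩ := hfin.exists_maximal hnonempty
  refine ⟨hsplits, r, ⟨hr.1, fun x hx => ?_⟩, ?_⟩
  · rcases le_total x r with h | h
    · exact h
    · exact hr.2 hx h
  · have hr0 : (qPoly θ m n d).eval r = 0 := hr.1
    -- A root r of f_d(x²) gives the root r²/θ of the polynomial with θ = 1.
    rw [hq, substSq, eval_comp, eval_pow, eval_X, show r ^ 2 = θ * (r ^ 2 / θ) by field_simp,
      powPoly_eval_mul] at hr0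
    have hy := powPoly_root_le_sq hn hm hd ((mul_eq_zero.1 hr0).resolve_left (by positivity))
    rw [div_le_iff₀ hθ0] at hy
    have e1 : √(θ * n / m) * √((d : ℝ) - 1) = √θ * √((n : ℝ) / m * (d - 1)) := by
      rw [mul_div_assoc, Real.sqrt_mul hθ0.le, Real.sqrt_mul (by positivity : 0 ≤ (n : ℝ) / m)]
      ring
    have e2 : √(θ * n / m) * √((d : ℝ) * m / n - 1) = √θ * √((d : ℝ) - n / m) := by
      rw [mul_div_assoc, Real.sqrt_mul hθ0.le, mul_assoc,
        ← Real.sqrt_mul (by positivity : 0 ≤ (n : ℝ) / m)]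
      congr 2
      field_simp
    rw [mul_add, e1, e2, ← mul_add]
    refine abs_le_of_sq_le_sq' ?_ (by positivity) |>.2
    rw [mul_pow, Real.sq_sqrt hθ0.le]
    linarith
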